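/- Let $k$ be a field and $C$ a $k$-coalgebra with comultiplication $\Delta$ and counit $\varepsilon$. Let $C_0\subseteq C_1\subseteq\cdots$ be the coradical filtration of $C$: $C_0$ is the sum of all simple subcoalgebras of $C$, and $C_{n+1}=\Delta^{-1}(C_n\otimes C+C\otimes C_0)$. For a right $C$-comodule $(M,\rho)$ let $M_0\subseteq M_1\subseteq\cdots$ be its Loewy series: $M_0$ is the socle (the sum of all simple subcomodules) of $M$, and $M_{n+1}/M_n$ is the socle of $M/M_n$. Put $C_{-1}=0$, $M_{-1}=0$, $\operatorname{gr}C=\bigoplus_{n\ge 0}C_n/C_{n-1}$ and $\operatorname{gr}M=\bigoplus_{n\ge 0}M_n/M_{n-1}$. One has $\Delta(C_n)\subseteq\sum_{i=0}^n C_i\otimes C_{n-i}$ and $\rho(M_n)\subseteq\sum_{i=0}^n M_i\otimes C_{n-i}$, and $\Delta$ and $\rho$ induce maps $C_n/C_{n-1}\to\bigoplus_{i=0}^n C_i/C_{i-1}\otimes C_{n-i}/C_{n-i-1}$ and $M_n/M_{n-1}\to\bigoplus_{i=0}^n M_i/M_{i-1}\otimes C_{n-i}/C_{n-i-1}$. These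 make $\operatorname{gr}C$ a graded coalgebra (with counit $\varepsilon$ on $C_0$ and zero in positive degrees) and $\operatorname{gr}M$ a graded right $\operatorname{gr}C$-comodule. Let $S$ be a simple right $C$-comodule with structure map $\rho_S$, and let $\iota:S\to E$ be an injective envelope of $S$ in the category of right $C$-comodules. Since $\rho_S(S)\subseteq S\otimes C_0$ and $C_0$ is the degree-zero component of $\operatorname{gr}C$, the map $\rho_S$ makes $S$ a right $\operatorname{gr}C$-comodule. Theorem. $S$ is a simple right $\operatorname{gr}C$-comodule, and $\operatorname{gr}E$ is isomorphic to the injective envelope of $S$ in the category of right $\operatorname{gr}C$-comodules. More precisely, $\iota(S)\subseteq E_0$, the map $j:S\to E_0\subseteq\operatorname{gr}E$, $s\mapsto\iota(s)$, is an injective envelope of $S$ over $\operatorname{gr}C$, and for every injective envelope $j':S\to F$ of $S$ over $\operatorname{gr}C$ there is an isomorphism of right $\operatorname{gr}C$-comodules $e:\operatorname{gr}E\to F$ with $e\circ j=j'$. -/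

import Mathlib

open scoped TensorProduct

universe u

namespace CoalgGr

section Linear

variable {k M M' V V' : Type*} [Field k] [AddCommGroup M] [Module k M] [AddCommGroup M'] [Module k M']
  [AddCommGroup V] [Module k V] [AddCommGroup V'] [Module k V']

/-- For subspaces `N ⊆ M` and `P ⊆ V`, the subspace `N ⊗ P` of `M ⊗ V`. -/
def tens (N : Submodule k M) (P : Submodule k V) : Submodule k (M ⊗[k] V) :=
  Submodule.map₂ (TensorProduct.mk k M V) N P

lemma tmul_mem_tens {N : Submodule k M} {P : Submodule k V} {m : M} {v : V} (hm : m ∈ N)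
    (hv : v ∈ P) : m ⊗ₜ[k] v ∈ tens N P :=
  Submodule.apply_mem_map₂ (TensorProduct.mk k M V) hm hv

lemma tens_le {N : Submodule k M} {P : Submodule k V} {Q : Submodule k (M ⊗[k] V)}
    (h : ∀ m ∈ N, ∀ v ∈ P, m ⊗ₜ[k] v ∈ Q) : tens N P ≤ Q :=
  Submodule.map₂_le.2 h

lemma tens_mono {N N' : Submodule k M} {P P' : Submodule k V} (h : N ≤ N') (h' : P ≤ P') :
    tens N P ≤ tens N' P' :=
  Submodule.map₂_le_map₂ h h'

lemma mem_tens_top (x : M ⊗[k] V) : x ∈ tens (⊤ : Submodule k M) (⊤ : Submodule k V) := by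
  induction x with
  | zero => exact zero_mem _
  | tmul m v => exact tmul_mem_tens trivial trivial
  | add x y hx hy => exact add_mem hx hy

lemma map_mem_tens {N : Submodule k M} {P : Submodule k V} {N' : Submodule k M'}
    {P' : Submodule k V'} {f : M →ₗ[k] M'} {g : V →ₗ[k] V'} (hf : ∀ m ∈ N, f m ∈ N')
    (hg : ∀ v ∈ P, g v ∈ P') {x : M ⊗[k] V} (hx : x ∈ tens N P) :
    TensorProduct.map f g x ∈ tens N' P' := by
  have : tens N P ≤ (tens N' P').comap (TensorProduct.map f g) :=
    tens_le fun m hm v hv => tmul_mem_tens (hf m hm) (hg v hv)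
  exact this hx

/-- Contraction of the first tensor factor with a linear form. -/
def ctrL (f : M →ₗ[k] k) : M ⊗[k] V →ₗ[k] V :=
  (TensorProduct.lid k V).toLinearMap ∘ₗ f.rTensor V

/-- Contraction of the second tensor factor with a linear form. -/
def ctrR (g : V →ₗ[k] k) : M ⊗[k] V →ₗ[k] M :=
  (TensorProduct.rid k M).toLinearMap ∘ₗ g.lTensor M

@[simp] lemma ctrL_tmul (f : M →ₗ[k] k) (m : M) (v : V) : ctrL f (m ⊗ₜ[k] v) = f m • v := by
  simp [ctrL]

@[simp] lemma ctrR_tmul (g : V →ₗ[k] k) (m : M) (v : V) : ctrR g (m ⊗ₜ[k] v) = g v • m := by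
  simp [ctrR]

lemma exists_section (N : Submodule k M) :
    ∃ s : (M ⧸ N) →ₗ[k] M, ∀ y, N.mkQ (s y) = y := by
  obtain ⟨s, hs⟩ := N.mkQ.exists_rightInverse_of_surjective (by simp)
  exact ⟨s, fun y => LinearMap.congr_fun hs y⟩

lemma mem_tens_right_of_ctrL {P : Submodule k V} {x : M ⊗[k] V}
    (h : ∀ f : M →ₗ[k] k, ctrL f x ∈ P) : x ∈ tens ⊤ P := by
  classical
  let b := Module.Basis.ofVectorSpace k M
  let e : M ⊗[k] V ≃ₗ[k] _ →₀ V := TensorProduct.equivFinsuppOfBasisLeft b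
  rw [← e.symm_apply_apply x, TensorProduct.equivFinsuppOfBasisLeft_symm_apply]
  refine Submodule.sum_mem _ fun i _ => tmul_mem_tens trivial ?_
  rw [TensorProduct.equivFinsuppOfBasisLeft_apply]
  exact h _

lemma sub_section_mem {N : Submodule k M} {s : (M ⧸ N) →ₗ[k] M} (hs : ∀ y, N.mkQ (s y) = y)
    (x : M ⊗[k] V) : x - (s ∘ₗ N.mkQ).rTensor V x ∈ tens N ⊤ := by
  induction x with
  | zero => simp
  | tmul m v =>
    rw [LinearMap.rTensor_tmul, ← TensorProduct.sub_tmul]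
    refine tmul_mem_tens ?_ trivial
    rw [← Submodule.Quotient.mk_eq_zero, ← Submodule.mkQ_apply, map_sub, LinearMap.comp_apply, hs,
      sub_self]
  | add x y hx hy =>
    rw [map_add, add_sub_add_comm]
    exact add_mem hx hy

lemma mem_sup_of_mkQ {N : Submodule k M} {P : Submodule k V} {x : M ⊗[k] V}
    (h : N.mkQ.rTensor V x ∈ tens ⊤ P) : x ∈ tens N ⊤ ⊔ tens ⊤ P := by
  obtain ⟨s, hs⟩ := exists_section N
  rw [← sub_add_cancel x ((s ∘ₗ N.mkQ).rTensor V x)]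
  refine Submodule.add_mem_sup (sub_section_mem hs x) ?_
  rw [LinearMap.rTensor_comp_apply]
  exact map_mem_tens (N' := ⊤) (f := s) (g := LinearMap.id) (fun _ _ => trivial)
    (fun v hv => hv) h

lemma mkQ_mem_of_mem_sup {N : Submodule k M} {P : Submodule k V} {x : M ⊗[k] V}
    (h : x ∈ tens N ⊤ ⊔ tens ⊤ P) : N.mkQ.rTensor V x ∈ tens ⊤ P := by
  have : tens N ⊤ ⊔ tens ⊤ P ≤ (tens ⊤ P).comap (N.mkQ.rTensor V) := by
    refine sup_le (tens_le fun m hm v _ => ?_) (tens_le fun m _ v hv => ?_)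
    · have : N.mkQ m = 0 := by simpa using hm
      simp only [Submodule.mem_comap, LinearMap.rTensor_tmul, this, TensorProduct.zero_tmul,
        zero_mem]
    · exact tmul_mem_tens trivial hv
  exact this h

lemma mem_sup_of_ctrL {N : Submodule k M} {P : Submodule k V} {x : M ⊗[k] V}
    (h : ∀ f : M →ₗ[k] k, (∀ m ∈ N, f m = 0) → ctrL f x ∈ P) : x ∈ tens N ⊤ ⊔ tens ⊤ P := by
  refine mem_sup_of_mkQ (mem_tens_right_of_ctrL fun f => ?_)
  have : ctrL f (N.mkQ.rTensor V x) = ctrL (f ∘ₗ N.mkQ) x := by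
    simp [ctrL, LinearMap.rTensor_comp_apply]
  rw [this]
  refine h _ fun m hm => ?_
  have : N.mkQ m = 0 := by simpa using hm
  rw [LinearMap.comp_apply, this, map_zero]

lemma ctrL_mem_of_mem_sup {N : Submodule k M} {P : Submodule k V} {x : M ⊗[k] V}
    (h : x ∈ tens N ⊤ ⊔ tens ⊤ P) {f : M →ₗ[k] k} (hf : ∀ m ∈ N, f m = 0) : ctrL f x ∈ P := by
  have : tens N ⊤ ⊔ tens ⊤ P ≤ P.comap (ctrL f) := by
    refine sup_le (tens_le fun m hm v _ => ?_) (tens_le fun m _ v hv => ?_)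
    · simp [hf m hm]
    · simpa using P.smul_mem _ hv
  exact this h

lemma ctrL_mem {P : Submodule k V} {x : M ⊗[k] V} (h : x ∈ tens ⊤ P) (f : M →ₗ[k] k) :
    ctrL f x ∈ P := by
  have : tens ⊤ P ≤ P.comap (ctrL f) := by
    refine tens_le fun m _ v hv => ?_
    simpa using P.smul_mem _ hv
  exact this h

lemma ctrR_mem {N : Submodule k M} {x : M ⊗[k] V} (h : x ∈ tens N ⊤) (g : V →ₗ[k] k) :
    ctrR g x ∈ N := by
  have : tens N ⊤ ≤ N.comap (ctrR g) := by
    refine tens_le fun m hm v _ => ?_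
    simpa using N.smul_mem _ hm
  exact this h

lemma mem_tens_left_of_ctrR {N : Submodule k M} {x : M ⊗[k] V}
    (h : ∀ g : V →ₗ[k] k, ctrR g x ∈ N) : x ∈ tens N ⊤ := by
  have h1 : TensorProduct.comm k M V x ∈ tens ⊤ N := by
    refine mem_tens_right_of_ctrL fun g => ?_
    have : ctrL g ∘ₗ (TensorProduct.comm k M V).toLinearMap = ctrR g :=
      TensorProduct.ext' fun m v => by simp
    have := LinearMap.congr_fun this x
    rw [LinearMap.comp_apply, LinearEquiv.coe_coe] at this
    rw [this]
    exact h g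
  have h2 : tens ⊤ N ≤ (tens N ⊤).comap (TensorProduct.comm k V M).toLinearMap :=
    tens_le fun v _ m hm => tmul_mem_tens hm trivial
  simpa using h2 h1

lemma mem_tens_of_mem_of_mem {N : Submodule k M} {P : Submodule k V} {x : M ⊗[k] V}
    (h1 : x ∈ tens N ⊤) (h2 : x ∈ tens ⊤ P) : x ∈ tens N P := by
  obtain ⟨r, hr⟩ := N.subtype.exists_leftInverse_of_injective (by simp)
  have key : ∀ y ∈ tens N (⊤ : Submodule k V), (N.subtype ∘ₗ r).rTensor V y = y := by
    intro y hy
    have : tens N (⊤ : Submodule k V) ≤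
        LinearMap.eqLocus ((N.subtype ∘ₗ r).rTensor V) LinearMap.id := by
      refine tens_le fun m hm v _ => ?_
      have : r m = ⟨m, hm⟩ := LinearMap.congr_fun hr ⟨m, hm⟩
      simp [LinearMap.mem_eqLocus, this]
    exact this hy
  rw [← key x h1]
  exact map_mem_tens (f := N.subtype ∘ₗ r) (g := LinearMap.id) (fun m _ => (r m).2)
    (fun v hv => hv) h2

end Linear

section Comodule

variable (k C : Type*) [Field k] [AddCommGroup C] [Module k C] [Coalgebra k C]

/-- A right comodule `M` over the `k`-coalgebra `C`, with structure map `ρ : M → M ⊗ C`. -/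
class RightComodule (M : Type*) [AddCommGroup M] [Module k M] where
  /-- the structure map -/
  coact : M →ₗ[k] M ⊗[k] C
  /-- `(ρ ⊗ I) ρ = (I ⊗ Δ) ρ` -/
  coassoc : (TensorProduct.assoc k M C C).toLinearMap ∘ₗ coact.rTensor C ∘ₗ coact =
    (Coalgebra.comul (R := k) (A := C)).lTensor M ∘ₗ coact
  /-- `(I ⊗ ε) ρ = I` -/
  counit : (TensorProduct.rid k M).toLinearMap ∘ₗ
    (Coalgebra.counit (R := k) (A := C)).lTensor M ∘ₗ coact = LinearMap.id

/-- The coalgebra `C` as a right comodule over itself. -/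
instance regularComodule : RightComodule k C C where
  coact := Coalgebra.comul
  coassoc := Coalgebra.coassoc
  counit := by
    rw [Coalgebra.lTensor_counit_comp_comul]
    ext c
    simp

variable {M N : Type*} [AddCommGroup M] [Module k M] [RightComodule k C M]
  [AddCommGroup N] [Module k N] [RightComodule k C N]

/-- The structure map of a right comodule. -/
abbrev ρ (M : Type*) [AddCommGroup M] [Module k M] [RightComodule k C M] : M →ₗ[k] M ⊗[k] C :=
  RightComodule.coact

/-- Morphisms of right `C`-comodules. -/
def IsComoduleHom (f : M →ₗ[k] N) : Prop :=
  ρ k C N ∘ₗ f = f.rTensor C ∘ₗ ρ k C M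

/-- A subspace `P` is a subcomodule if `ρ(P) ⊆ P ⊗ C`. -/
def IsSubcomodule (P : Submodule k M) : Prop :=
  ∀ m ∈ P, ρ k C M m ∈ tens P ⊤

/-- A subspace `P` is a simple subcomodule if it is a subcomodule, is nonzero, and contains no
other subcomodules than `0` and `P`. -/
def IsSimpleSubcomodule (P : Submodule k M) : Prop :=
  IsSubcomodule k C P ∧ P ≠ ⊥ ∧ ∀ Q ≤ P, IsSubcomodule k C Q → Q = ⊥ ∨ Q = P

variable (M) in
/-- The comodule `M` is simple: it is nonzero and its only subcomodules are `0` and `M`. -/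
def IsSimpleComodule : Prop :=
  Nontrivial M ∧ ∀ Q : Submodule k M, IsSubcomodule k C Q → Q = ⊥ ∨ Q = ⊤

variable (M) in
/-- The socle of `M`: the sum of all simple subcomodules. -/
def socle : Submodule k M :=
  sSup {P | IsSimpleSubcomodule k C P}

/-- A subspace `D` of `C` is a subcoalgebra if `Δ(D) ⊆ D ⊗ D`. -/
def IsSubcoalgebra (D : Submodule k C) : Prop :=
  ∀ d ∈ D, Coalgebra.comul (R := k) d ∈ tens D D

/-- A subspace `D` is a simple subcoalgebra if it is a subcoalgebra, is nonzero, and contains no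
other subcoalgebras than `0` and `D`. -/
def IsSimpleSubcoalgebra (D : Submodule k C) : Prop :=
  IsSubcoalgebra k C D ∧ D ≠ ⊥ ∧ ∀ D' ≤ D, IsSubcoalgebra k C D' → D' = ⊥ ∨ D' = D

/-- The coradical of `C`: the sum of all simple subcoalgebras. -/
def coradical : Submodule k C :=
  sSup {D | IsSimpleSubcoalgebra k C D}

variable {C} in
/-- The wedge `X ∧ Y = Δ⁻¹(X ⊗ C + C ⊗ Y)`. -/
def wedge (X Y : Submodule k C) : Submodule k C :=
  (tens X ⊤ ⊔ tens ⊤ Y).comap (Coalgebra.comul (R := k))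

/-- The coradical filtration: `C₀` is the coradical and `Cₙ₊₁ = Cₙ ∧ C₀`. -/
def coradicalFiltration : ℕ → Submodule k C
  | 0 => coradical k C
  | n + 1 => wedge k (coradicalFiltration n) (coradical k C)

/-! ### Subcomodules through the action of the dual space -/

/-- The action of a linear form `g` on `C` on a right comodule: `m ↦ ∑ g(m₁) m₀`. -/
def act (M : Type*) [AddCommGroup M] [Module k M] [RightComodule k C M] (g : C →ₗ[k] k) :
    M →ₗ[k] M :=
  ctrR g ∘ₗ ρ k C M

variable {k C}

lemma isSubcomodule_iff {P : Submodule k M} :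
    IsSubcomodule k C P ↔ ∀ g : C →ₗ[k] k, ∀ m ∈ P, act k C M g m ∈ P :=
  ⟨fun h g m hm => ctrR_mem (h m hm) g, fun h m hm => mem_tens_left_of_ctrR fun g => h g m hm⟩

lemma IsSubcomodule.inf {P Q : Submodule k M} (hP : IsSubcomodule k C P)
    (hQ : IsSubcomodule k C Q) : IsSubcomodule k C (P ⊓ Q) := by
  rw [isSubcomodule_iff] at *
  exact fun g m hm => ⟨hP g m hm.1, hQ g m hm.2⟩

lemma isSubcomodule_sSup {A : Set (Submodule k M)} (h : ∀ P ∈ A, IsSubcomodule k C P) :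
    IsSubcomodule k C (sSup A) := by
  rw [isSubcomodule_iff]
  intro g
  change sSup A ≤ (sSup A).comap (act k C M g)
  exact sSup_le fun P hP m hm =>
    (le_sSup hP : P ≤ sSup A) (isSubcomodule_iff.1 (h P hP) g m hm)

lemma IsSubcomodule.sup {P Q : Submodule k M} (hP : IsSubcomodule k C P)
    (hQ : IsSubcomodule k C Q) : IsSubcomodule k C (P ⊔ Q) := by
  rw [← sSup_pair]
  refine isSubcomodule_sSup ?_
  rintro R (rfl | rfl)
  exacts [hP, hQ]

lemma isSubcomodule_bot : IsSubcomodule k C (⊥ : Submodule k M) := by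
  rw [isSubcomodule_iff]
  rintro g m hm
  rw [Submodule.mem_bot] at *
  rw [hm, map_zero]

lemma IsComoduleHom.act {f : M →ₗ[k] N} (hf : IsComoduleHom k C f) (g : C →ₗ[k] k) (m : M) :
    f (act k C M g m) = act k C N g (f m) := by
  have h1 : f ∘ₗ ctrR g = ctrR g ∘ₗ f.rTensor C := TensorProduct.ext' fun m c => by simp
  have h2 := LinearMap.congr_fun hf m
  have h3 := LinearMap.congr_fun h1 (ρ k C M m)
  simp only [LinearMap.comp_apply] at h2 h3
  simp only [CoalgGr.act, LinearMap.comp_apply, h2, h3]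

lemma IsComoduleHom.comap {f : M →ₗ[k] N} (hf : IsComoduleHom k C f) {P : Submodule k N}
    (hP : IsSubcomodule k C P) : IsSubcomodule k C (P.comap f) := by
  rw [isSubcomodule_iff] at *
  intro g m hm
  rw [Submodule.mem_comap, hf.act]
  exact hP g _ hm

lemma IsComoduleHom.map {f : M →ₗ[k] N} (hf : IsComoduleHom k C f) {P : Submodule k M}
    (hP : IsSubcomodule k C P) : IsSubcomodule k C (P.map f) := by
  rw [isSubcomodule_iff] at *
  rintro g _ ⟨m, hm, rfl⟩
  rw [← hf.act]
  exact ⟨_, hP g _ hm, rfl⟩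

lemma isSubcomodule_socle : IsSubcomodule k C (socle k C M) :=
  isSubcomodule_sSup fun _ hP => hP.1

/-! ### Coefficients -/

variable (k C) in
/-- The coefficient map `m ↦ ∑ f(m₀) m₁` of a linear form `f` on `M`. -/
def coeff (f : M →ₗ[k] k) : M →ₗ[k] C :=
  ctrL f ∘ₗ ρ k C M

lemma coassoc_apply (m : M) :
    TensorProduct.assoc k M C C ((ρ k C M).rTensor C (ρ k C M m)) =
      (Coalgebra.comul (R := k) (A := C)).lTensor M (ρ k C M m) :=
  LinearMap.congr_fun RightComodule.coassoc m

lemma coeff_hom (f : M →ₗ[k] k) : IsComoduleHom k C (coeff k C f) := by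
  have h1 : (Coalgebra.comul (R := k) (A := C)) ∘ₗ ctrL f =
      ctrL f ∘ₗ (Coalgebra.comul (R := k) (A := C)).lTensor M :=
    TensorProduct.ext' fun m c => by simp
  have h2 : ctrL f ∘ₗ (TensorProduct.assoc k M C C).toLinearMap = (ctrL f).rTensor C :=
    TensorProduct.ext_threefold fun m c d => by simp [TensorProduct.smul_tmul']
  refine LinearMap.ext fun m => ?_
  have h1' := LinearMap.congr_fun h1 (ρ k C M m)
  have h2' := LinearMap.congr_fun h2 ((ρ k C M).rTensor C (ρ k C M m))
  simp only [LinearMap.comp_apply, LinearEquiv.coe_coe] at h1' h2'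
  change Coalgebra.comul (ctrL f (ρ k C M m)) = (ctrL f ∘ₗ ρ k C M).rTensor C (ρ k C M m)
  rw [h1', ← coassoc_apply, h2', LinearMap.rTensor_comp_apply]

lemma comul_coeff (f : M →ₗ[k] k) (m : M) :
    Coalgebra.comul (coeff k C f m) = (coeff k C f).rTensor C (ρ k C M m) :=
  LinearMap.congr_fun (coeff_hom f) m

lemma coact_act (g : C →ₗ[k] k) (m : M) :
    ρ k C M (act k C M g m) = (act k C C g).lTensor M (ρ k C M m) := by
  have h1 : ρ k C M ∘ₗ ctrR g = ctrR g ∘ₗ (ρ k C M).rTensor C :=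
    TensorProduct.ext' fun m c => by simp
  have h2 : (ctrR g).lTensor M ∘ₗ (TensorProduct.assoc k M C C).toLinearMap = ctrR g :=
    TensorProduct.ext_threefold fun m c d => by simp
  have h1' := LinearMap.congr_fun h1 (ρ k C M m)
  have h2' := LinearMap.congr_fun h2 ((ρ k C M).rTensor C (ρ k C M m))
  simp only [LinearMap.comp_apply, LinearEquiv.coe_coe] at h1' h2'
  change ρ k C M (ctrR g (ρ k C M m)) = (ctrR g ∘ₗ Coalgebra.comul).lTensor M (ρ k C M m)
  rw [h1', ← h2', coassoc_apply, LinearMap.lTensor_comp_apply]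

lemma counit_coeff (f : M →ₗ[k] k) (m : M) : Coalgebra.counit (coeff k C f m) = f m := by
  have h1 : (Coalgebra.counit (R := k) (A := C)) ∘ₗ ctrL f =
      f ∘ₗ (TensorProduct.rid k M).toLinearMap ∘ₗ
        (Coalgebra.counit (R := k) (A := C)).lTensor M :=
    TensorProduct.ext' fun m c => by simp [mul_comm]
  have h2 := LinearMap.congr_fun (RightComodule.counit (k := k) (C := C) (M := M)) m
  have h1' := LinearMap.congr_fun h1 (ρ k C M m)
  simp only [LinearMap.comp_apply, LinearEquiv.coe_coe, LinearMap.id_apply] at h1' h2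
  change Coalgebra.counit (ctrL f (ρ k C M m)) = f m
  rw [h1', h2]

/-- If a nonzero subcomodule of a finite sum of coefficient spaces of the simple subcomodule `T`
lies in the subcoalgebra `D`, then all coefficients of `T` lie in `D`. -/
lemma coact_mem_of_finset {T : Submodule k M} (hT : IsSimpleSubcomodule k C T)
    {D : Submodule k C} (hD : IsSubcoalgebra k C D) (s : Finset (M →ₗ[k] k)) :
    ∀ P : Submodule k C, IsSubcomodule k C P → P ≠ ⊥ → P ≤ D →
      P ≤ s.sup (fun f => T.map (coeff k C f)) → ∀ t ∈ T, ρ k C M t ∈ tens ⊤ D := by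
  classical
  induction s using Finset.induction_on with
  | empty =>
    intro P _ h0 _ h1
    exact absurd (le_bot_iff.1 (by simpa using h1)) h0
  | insert f s _ ih =>
    intro P hP h0 hPD h1 t ht
    rw [Finset.sup_insert] at h1
    set A := s.sup (fun f => T.map (coeff k C f)) with hA
    have hAsub : IsSubcomodule k C A := by
      rw [hA]
      clear_value A
      clear ih h1 hA
      induction s using Finset.induction_on with
      | empty => exact isSubcomodule_bot
      | insert f s _ ih =>
        rw [Finset.sup_insert]
        exact ((coeff_hom f).map hT.1).sup (ih (by simp_all))
    by_cases hPA : P ⊓ A = ⊥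
    swap
    · exact ih (P ⊓ A) (hP.inf hAsub) hPA (inf_le_left.trans hPD) inf_le_right t ht
    have hK : T ⊓ A.comap (coeff k C f) = ⊥ := by
      refine (hT.2.2 _ inf_le_left (hT.1.inf ((coeff_hom f).comap hAsub))).resolve_right ?_
      intro h
      have h2 : T.map (coeff k C f) ≤ A := Submodule.map_le_iff_le_comap.2 (inf_eq_left.1 h)
      rw [sup_eq_right.2 h2] at h1
      exact h0 (by rw [← hPA, inf_eq_left.2 h1])
    have hL : T ≤ (P ⊔ A).comap (coeff k C f) := by
      refine inf_eq_left.1 ((hT.2.2 (T ⊓ (P ⊔ A).comap (coeff k C f)) inf_le_left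
        (hT.1.inf ((coeff_hom f).comap (hP.sup hAsub)))).resolve_left ?_)
      intro h
      apply h0
      rw [eq_bot_iff]
      intro p hp
      obtain ⟨_, ⟨u, hu, rfl⟩, a, ha, rfl⟩ := Submodule.mem_sup.1 (h1 hp)
      have hu' : coeff k C f u ∈ P ⊔ A := by
        have := Submodule.sub_mem _ ((le_sup_left : P ≤ P ⊔ A) hp)
          ((le_sup_right : A ≤ P ⊔ A) ha)
        simpa using this
      have : u ∈ (⊥ : Submodule k M) := h ▸ ⟨hu, hu'⟩
      rw [Submodule.mem_bot] at this
      subst this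
      rw [map_zero, zero_add] at hp ⊢
      rw [← hPA]
      exact ⟨hp, ha⟩
    -- the map `T → C / A` is injective; choose a left inverse
    obtain ⟨r, hr⟩ := (A.mkQ ∘ₗ coeff k C f ∘ₗ T.subtype).exists_leftInverse_of_injective (by
      rw [LinearMap.ker_eq_bot']
      rintro ⟨u, hu⟩ h
      have h3 : coeff k C f u ∈ A := by simpa using h
      have : u ∈ (⊥ : Submodule k M) := hK ▸ ⟨hu, h3⟩
      simpa using this)
    have hr' : ∀ y ∈ tens T (⊤ : Submodule k C),
        (T.subtype ∘ₗ r ∘ₗ A.mkQ ∘ₗ coeff k C f).rTensor C y = y := by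
      intro y hy
      have : tens T (⊤ : Submodule k C) ≤ LinearMap.eqLocus
          ((T.subtype ∘ₗ r ∘ₗ A.mkQ ∘ₗ coeff k C f).rTensor C) LinearMap.id := by
        refine tens_le fun m hm v _ => ?_
        have : r (A.mkQ (coeff k C f m)) = ⟨m, hm⟩ := LinearMap.congr_fun hr ⟨m, hm⟩
        rw [LinearMap.mem_eqLocus, LinearMap.rTensor_tmul]
        simp only [LinearMap.comp_apply, this, Submodule.subtype_apply, LinearMap.id_apply]
      exact this hy
    rw [← hr' _ (hT.1 t ht), LinearMap.rTensor_comp_apply, LinearMap.rTensor_comp_apply,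
      LinearMap.rTensor_comp_apply, ← comul_coeff]
    obtain ⟨p, hp, a, ha, hpa⟩ := Submodule.mem_sup.1 (hL ht)
    have h4 : A.mkQ.rTensor C (Coalgebra.comul (coeff k C f t)) ∈ tens ⊤ D := by
      refine mkQ_mem_of_mem_sup ?_
      rw [← hpa, map_add, add_comm]
      refine Submodule.add_mem_sup (hAsub a ha) ?_
      exact tens_mono le_top le_rfl (hD p (hPD hp))
    refine map_mem_tens (f := T.subtype) (g := LinearMap.id) (N := ⊤) (N' := ⊤) (fun _ _ => trivial)
      (fun v hv => hv) ?_
    exact map_mem_tens (f := r) (g := LinearMap.id) (N := ⊤) (N' := ⊤) (fun _ _ => trivial)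
      (fun v hv => hv) h4

/-- The coefficients of a simple subcomodule lie in the coradical. -/
lemma coact_mem_of_simple {T : Submodule k M} (hT : IsSimpleSubcomodule k C T) {t : M}
    (ht : t ∈ T) : ρ k C M t ∈ tens ⊤ (coradical k C) := by
  classical
  set D : Submodule k C := ⨆ f : M →ₗ[k] k, T.map (coeff k C f) with hD
  have hcoef : ∀ (f : M →ₗ[k] k), ∀ t ∈ T, coeff k C f t ∈ D := fun f t ht =>
    (le_iSup (fun f : M →ₗ[k] k => T.map (coeff k C f)) f) ⟨t, ht, rfl⟩
  have hTD : ∀ t ∈ T, ρ k C M t ∈ tens ⊤ D := fun t ht =>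
    mem_tens_right_of_ctrL fun f => hcoef f t ht
  have hTD' : ∀ t ∈ T, ρ k C M t ∈ tens T D := fun t ht =>
    mem_tens_of_mem_of_mem (hT.1 t ht) (hTD t ht)
  have hDsub : IsSubcoalgebra k C D := by
    change D ≤ (tens D D).comap (Coalgebra.comul (R := k))
    refine iSup_le fun f => ?_
    rintro _ ⟨t, ht, rfl⟩
    rw [Submodule.mem_comap, comul_coeff]
    exact map_mem_tens (g := LinearMap.id) (hcoef f) (fun v hv => hv) (hTD' t ht)
  have hDsimple : IsSimpleSubcoalgebra k C D := by
    refine ⟨hDsub, fun h => ?_, fun D' hle hD' => ?_⟩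
    · apply hT.2.1
      rw [eq_bot_iff]
      intro t ht
      rw [Submodule.mem_bot, ← Module.forall_dual_apply_eq_zero_iff k]
      intro f
      have : coeff k C f t ∈ (⊥ : Submodule k C) := h ▸ hcoef f t ht
      rw [← counit_coeff (C := C), (Submodule.mem_bot k).1 this, map_zero]
    · by_cases h0 : D' = ⊥
      · exact Or.inl h0
      refine Or.inr (le_antisymm hle ?_)
      obtain ⟨d, hd, hd0⟩ := Submodule.exists_mem_ne_zero_of_ne_bot h0
      obtain ⟨s, hs⟩ := Submodule.mem_iSup_iff_exists_finset.1 (hle hd)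
      have key := coact_mem_of_finset hT hD' s (D' ⊓ s.sup (fun f => T.map (coeff k C f)))
        (IsSubcomodule.inf (fun d hd => tens_mono le_rfl le_top (hD' d hd)) (by
          rw [Finset.sup_eq_iSup, ← sSup_range]
          refine isSubcomodule_sSup ?_
          rintro _ ⟨f, rfl⟩
          by_cases hf : f ∈ s
          · simpa [hf] using (coeff_hom f).map hT.1
          · simpa [hf] using isSubcomodule_bot))
        (fun h => hd0 (by
          rw [← Submodule.mem_bot k, ← h]
          refine ⟨hd, ?_⟩
          rwa [Finset.sup_eq_iSup])) inf_le_left inf_le_right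
      refine iSup_le fun f => ?_
      rintro _ ⟨t, ht, rfl⟩
      exact ctrL_mem (key t ht) f
  exact tens_mono le_rfl (le_sSup hDsimple) (hTD t ht)

lemma coact_mem_of_mem_socle {m : M} (hm : m ∈ socle k C M) :
    ρ k C M m ∈ tens ⊤ (coradical k C) := by
  have : socle k C M ≤ (tens ⊤ (coradical k C)).comap (ρ k C M) :=
    sSup_le fun P hP t ht => coact_mem_of_simple hP ht
  exact this hm

/-- A simple comodule is equal to its socle. -/
lemma IsSimpleComodule.socle_eq_top (h : IsSimpleComodule k C M) : socle k C M = ⊤ := by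
  refine top_le_iff.1 (le_sSup (a := (⊤ : Submodule k M)) ⟨fun m _ => mem_tens_top _, ?_,
    fun Q _ hQ => h.2 Q hQ⟩)
  have := h.1
  exact top_ne_bot

end Comodule

section Loewy

variable (k C : Type*) [Field k] [AddCommGroup C] [Module k C] [Coalgebra k C]
  {M : Type*} [AddCommGroup M] [Module k M] [RightComodule k C M]

variable {k C} in
/-- The structure map of the factor comodule `M / P`, induced by that of `M`. -/
def quotientCoact {P : Submodule k M} (hP : IsSubcomodule k C P) :
    (M ⧸ P) →ₗ[k] (M ⧸ P) ⊗[k] C :=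
  P.liftQ (P.mkQ.rTensor C ∘ₗ ρ k C M) fun m hm => by
    have : tens P ⊤ ≤ LinearMap.ker (P.mkQ.rTensor C) := tens_le fun m hm c _ => by
      have : P.mkQ m = 0 := by simpa using hm
      rw [LinearMap.mem_ker, LinearMap.rTensor_tmul, this, TensorProduct.zero_tmul]
    exact this (hP m hm)

variable {k C} in
lemma quotientCoact_mkQ {P : Submodule k M} (hP : IsSubcomodule k C P) (m : M) :
    quotientCoact hP (P.mkQ m) = P.mkQ.rTensor C (ρ k C M m) :=
  rfl

variable {k C} in
/-- The factor comodule `M / P` of a comodule `M` by a subcomodule `P`. -/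
@[reducible] def IsSubcomodule.quotient {P : Submodule k M} (hP : IsSubcomodule k C P) :
    RightComodule k C (M ⧸ P) where
  coact := quotientCoact hP
  coassoc := by
    refine Submodule.linearMap_qext _ (LinearMap.ext fun m => ?_)
    have h0 := quotientCoact_mkQ hP
    have h1 : (quotientCoact hP).rTensor C ∘ₗ P.mkQ.rTensor C =
        (P.mkQ.rTensor C).rTensor C ∘ₗ (ρ k C M).rTensor C :=
      TensorProduct.ext' fun m c => by simp only [LinearMap.comp_apply, LinearMap.rTensor_tmul, h0]
    have h2 : (TensorProduct.assoc k (M ⧸ P) C C).toLinearMap ∘ₗ (P.mkQ.rTensor C).rTensor C =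
        P.mkQ.rTensor (C ⊗[k] C) ∘ₗ (TensorProduct.assoc k M C C).toLinearMap :=
      TensorProduct.ext_threefold fun m c d => by simp
    have h3 : (Coalgebra.comul (R := k) (A := C)).lTensor (M ⧸ P) ∘ₗ P.mkQ.rTensor C =
        P.mkQ.rTensor (C ⊗[k] C) ∘ₗ (Coalgebra.comul (R := k) (A := C)).lTensor M :=
      TensorProduct.ext' fun m c => by simp
    have h1' := LinearMap.congr_fun h1 (ρ k C M m)
    have h2' := LinearMap.congr_fun h2 ((ρ k C M).rTensor C (ρ k C M m))
    have h3' := LinearMap.congr_fun h3 (ρ k C M m)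
    simp only [LinearMap.comp_apply, LinearEquiv.coe_coe] at h1' h2' h3'
    simp only [LinearMap.comp_apply, LinearEquiv.coe_coe, h0, h1', h2', h3', coassoc_apply]
  counit := by
    refine Submodule.linearMap_qext _ (LinearMap.ext fun m => ?_)
    have h3 : (TensorProduct.rid k (M ⧸ P)).toLinearMap ∘ₗ
        (Coalgebra.counit (R := k) (A := C)).lTensor (M ⧸ P) ∘ₗ P.mkQ.rTensor C =
        P.mkQ ∘ₗ (TensorProduct.rid k M).toLinearMap ∘ₗ
          (Coalgebra.counit (R := k) (A := C)).lTensor M :=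
      TensorProduct.ext' fun m c => by simp
    have h3' := LinearMap.congr_fun h3 (ρ k C M m)
    have h4 := LinearMap.congr_fun (RightComodule.counit (k := k) (C := C) (M := M)) m
    simp only [LinearMap.comp_apply, LinearEquiv.coe_coe, LinearMap.id_apply] at h3' h4
    simp only [LinearMap.comp_apply, LinearEquiv.coe_coe, quotientCoact_mkQ,
      LinearMap.id_apply, h3', h4]

variable (M) in
/-- The Loewy series of `M`, each term together with the fact that it is a subcomodule: `M₀` is
the socle of `M`, and `Mₙ₊₁ / Mₙ` is the socle of `M / Mₙ`. -/
def loewyAux : ℕ → {P : Submodule k M // IsSubcomodule k C P}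
  | 0 => ⟨socle k C M, isSubcomodule_socle⟩
  | n + 1 =>
    let P := loewyAux n
    letI := P.2.quotient
    ⟨(socle k C (M ⧸ P.1)).comap P.1.mkQ,
      IsComoduleHom.comap (C := C) (f := P.1.mkQ) (LinearMap.ext fun _ => rfl)
        isSubcomodule_socle⟩

variable (M) in
/-- The Loewy series `M₀ ⊆ M₁ ⊆ …` of the comodule `M`. -/
def loewySeries (n : ℕ) : Submodule k M :=
  (loewyAux k C M n).1

end Loewy

noncomputable section Filtered

variable {k V W U : Type*} [Field k] [AddCommGroup V] [Module k V] [AddCommGroup W] [Module k W]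
  [AddCommGroup U] [Module k U]

/-- The previous term `Fₙ₋₁` of a filtration, with `F₋₁ = 0`. -/
def prev (F : ℕ → Submodule k V) : ℕ → Submodule k V
  | 0 => ⊥
  | n + 1 => F n

/-- The component `Fₙ / Fₙ₋₁`. -/
abbrev GrComponent (F : ℕ → Submodule k V) (n : ℕ) : Type _ :=
  F n ⧸ (prev F n).submoduleOf (F n)

/-- The graded space `⨁ₙ Fₙ / Fₙ₋₁`. -/
def Gr (F : ℕ → Submodule k V) : Type _ :=
  DirectSum ℕ (GrComponent F)

instance Gr.addCommGroup (F : ℕ → Submodule k V) : AddCommGroup (Gr F) :=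
  inferInstanceAs (AddCommGroup (DirectSum ℕ (GrComponent F)))

instance Gr.module (F : ℕ → Submodule k V) : Module k (Gr F) :=
  inferInstanceAs (Module k (DirectSum ℕ (GrComponent F)))

/-- The inclusion of the homogeneous component of degree `n`. -/
def Gr.lof (F : ℕ → Submodule k V) (n : ℕ) : GrComponent F n →ₗ[k] Gr F :=
  DirectSum.lof k ℕ (GrComponent F) n

/-- The linear map on the graded space given by linear maps on its homogeneous components. -/
def Gr.lift {F : ℕ → Submodule k V} {A : Type*} [AddCommMonoid A] [Module k A]
    (f : ∀ n, GrComponent F n →ₗ[k] A) : Gr F →ₗ[k] A :=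
  DirectSum.toModule k ℕ A f

lemma Gr.lift_lof {F : ℕ → Submodule k V} {A : Type*} [AddCommMonoid A] [Module k A]
    (f : ∀ n, GrComponent F n →ₗ[k] A) (n : ℕ) (x : GrComponent F n) :
    Gr.lift f (Gr.lof F n x) = f n x :=
  DirectSum.toModule_lof k n x

/-- The map `Fₙ → Fₙ / Fₙ₋₁ ⊆ gr F`. -/
def Gr.of (F : ℕ → Submodule k V) (n : ℕ) : F n →ₗ[k] Gr F :=
  Gr.lof F n ∘ₗ ((prev F n).submoduleOf (F n)).mkQ

/-- A linear extension to the whole space of the projection `Fₙ → Fₙ / Fₙ₋₁ ⊆ gr F`. -/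
def Gr.proj (F : ℕ → Submodule k V) (n : ℕ) : V →ₗ[k] Gr F :=
  Gr.lof F n ∘ₗ
    (LinearMap.exists_extend ((prev F n).submoduleOf (F n)).mkQ).choose

lemma Gr.proj_coe (F : ℕ → Submodule k V) (n : ℕ) (x : F n) : Gr.proj F n x = Gr.of F n x := by
  have := LinearMap.congr_fun
    (LinearMap.exists_extend ((prev F n).submoduleOf (F n)).mkQ).choose_spec x
  simp only [LinearMap.comp_apply, Submodule.subtype_apply] at this
  simp only [Gr.proj, Gr.of, LinearMap.comp_apply, this]

lemma Gr.proj_of_mem (F : ℕ → Submodule k V) (n : ℕ) {x : V} (hx : x ∈ F n) :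
    Gr.proj F n x = Gr.of F n ⟨x, hx⟩ :=
  Gr.proj_coe F n ⟨x, hx⟩

lemma Gr.of_eq_zero {F : ℕ → Submodule k V} {n : ℕ} {x : F n} (hx : (x : V) ∈ prev F n) :
    Gr.of F n x = 0 := by
  have : ((prev F n).submoduleOf (F n)).mkQ x = 0 := by
    rw [Submodule.mkQ_apply, Submodule.Quotient.mk_eq_zero]
    exact hx
  rw [Gr.of, LinearMap.comp_apply, this, map_zero]

lemma Gr.hom_ext {F : ℕ → Submodule k V} {A : Type*} [AddCommMonoid A] [Module k A]
    {f g : Gr F →ₗ[k] A}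
    (h : ∀ n (x : F n), f (Gr.of F n x) = g (Gr.of F n x)) : f = g := by
  refine DirectSum.linearMap_ext k fun n => LinearMap.ext fun y => ?_
  obtain ⟨x, rfl⟩ := Submodule.Quotient.mk_surjective _ y
  exact h n x

lemma prev_le {F : ℕ → Submodule k V} (hF : Monotone F) (n : ℕ) : prev F n ≤ F n := by
  cases n with
  | zero => exact bot_le
  | succ n => exact hF n.le_succ

lemma le_prev {F : ℕ → Submodule k V} (hF : Monotone F) {m n : ℕ} (h : m < n) :
    F m ≤ prev F n := by
  cases n with
  | zero => omega
  | succ n => exact hF (by omega)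

lemma Gr.proj_eq_zero {F : ℕ → Submodule k V} (hF : Monotone F) {m n : ℕ} (h : m < n) {x : V}
    (hx : x ∈ F m) : Gr.proj F n x = 0 := by
  have h1 := le_prev hF h hx
  rw [Gr.proj_of_mem F n (prev_le hF n h1)]
  exact Gr.of_eq_zero h1

/-- A linear map `φ : V → W ⊗ U` between spaces with ascending filtrations is filtered if
`φ(Fₙ) ⊆ ∑_{i+j=n} Gᵢ ⊗ Hⱼ`. -/
structure IsFiltered (F : ℕ → Submodule k V) (G : ℕ → Submodule k W) (H : ℕ → Submodule k U)
    (φ : V →ₗ[k] W ⊗[k] U) : Prop where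
  monoF : Monotone F
  monoG : Monotone G
  monoH : Monotone H
  map_mem : ∀ n, ∀ x ∈ F n, φ x ∈ (Finset.HasAntidiagonal.antidiagonal n).sup fun p => tens (G p.1) (H p.2)

variable {F : ℕ → Submodule k V} {G : ℕ → Submodule k W} {H : ℕ → Submodule k U}
  {φ : V →ₗ[k] W ⊗[k] U}

/-- The degree `n` part of `gr φ`, before passing to the quotient: the sum over `i + j = n` of
the projections to `(Gᵢ / Gᵢ₋₁) ⊗ (Hⱼ / Hⱼ₋₁)`, composed with `φ`. -/
def grAux (G : ℕ → Submodule k W) (H : ℕ → Submodule k U) (φ : V →ₗ[k] W ⊗[k] U) (n : ℕ) :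
    V →ₗ[k] Gr G ⊗[k] Gr H :=
  (∑ p ∈ Finset.HasAntidiagonal.antidiagonal n, TensorProduct.map (Gr.proj G p.1) (Gr.proj H p.2)) ∘ₗ φ

lemma IsFiltered.grAux_eq_zero (h : IsFiltered F G H φ) {m n : ℕ} (hmn : m < n) {x : V}
    (hx : x ∈ F m) : grAux G H φ n x = 0 := by
  have : (Finset.HasAntidiagonal.antidiagonal m).sup (fun p => tens (G p.1) (H p.2)) ≤ LinearMap.ker
      (∑ p ∈ Finset.HasAntidiagonal.antidiagonal n, TensorProduct.map (Gr.proj G p.1) (Gr.proj H p.2)) := by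
    refine Finset.sup_le fun p hp => tens_le fun w hw u hu => ?_
    rw [LinearMap.mem_ker, LinearMap.sum_apply]
    refine Finset.sum_eq_zero fun q hq => ?_
    rw [Finset.HasAntidiagonal.mem_antidiagonal] at hp hq
    rw [TensorProduct.map_tmul]
    rcases lt_or_ge p.1 q.1 with h1 | h1
    · rw [Gr.proj_eq_zero h.monoG h1 hw, TensorProduct.zero_tmul]
    · rw [Gr.proj_eq_zero h.monoH (by omega : p.2 < q.2) hu, TensorProduct.tmul_zero]
  exact this (h.map_mem m x hx)

/-- The map `gr φ : gr V → gr W ⊗ gr U` induced by a filtered map `φ : V → W ⊗ U`. -/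
def grMap (h : IsFiltered F G H φ) : Gr F →ₗ[k] Gr G ⊗[k] Gr H :=
  Gr.lift fun n =>
    ((prev F n).submoduleOf (F n)).liftQ ((grAux G H φ n).domRestrict (F n)) fun x hx => by
      rw [LinearMap.mem_ker, LinearMap.domRestrict_apply]
      cases n with
      | zero =>
        have : (x : V) = 0 := hx
        rw [this, map_zero]
      | succ n => exact h.grAux_eq_zero n.lt_succ_self hx

lemma grMap_of (h : IsFiltered F G H φ) (n : ℕ) (x : F n) :
    grMap h (Gr.of F n x) = grAux G H φ n x := by
  rw [grMap, Gr.of, LinearMap.comp_apply]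
  exact Gr.lift_lof _ n _

/-- If `φ(x) = ∑_{i+j=n} tᵢⱼ` with `tᵢⱼ ∈ Gᵢ ⊗ Hⱼ`, then `gr φ` maps the class of `x ∈ Fₙ` to
the sum of the classes of the `tᵢⱼ` in `(Gᵢ / Gᵢ₋₁) ⊗ (Hⱼ / Hⱼ₋₁)`. In particular `gr φ` does not
depend on any choice. -/
theorem grMap_of_repr (h : IsFiltered F G H φ) (n : ℕ) (x : F n)
    (t : (p : ℕ × ℕ) → G p.1 ⊗[k] H p.2)
    (ht : φ x = ∑ p ∈ Finset.HasAntidiagonal.antidiagonal n,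
      TensorProduct.map (G p.1).subtype (H p.2).subtype (t p)) :
    grMap h (Gr.of F n x) =
      ∑ p ∈ Finset.HasAntidiagonal.antidiagonal n, TensorProduct.map (Gr.of G p.1) (Gr.of H p.2) (t p) := by
  rw [grMap_of, grAux, LinearMap.comp_apply, ht, map_sum]
  refine Finset.sum_congr rfl fun p hp => ?_
  generalize t p = y
  induction y with
  | zero => simp only [map_zero]
  | add a b ha hb => simp only [map_add, ha, hb]
  | tmul w u =>
    rw [TensorProduct.map_tmul, LinearMap.sum_apply, Finset.sum_eq_single p]
    · rw [TensorProduct.map_tmul, TensorProduct.map_tmul, Submodule.subtype_apply,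
        Submodule.subtype_apply, Gr.proj_coe, Gr.proj_coe]
    · intro q hq hqp
      rw [Finset.HasAntidiagonal.mem_antidiagonal] at hp hq
      rw [TensorProduct.map_tmul, Submodule.subtype_apply, Submodule.subtype_apply]
      rcases lt_trichotomy p.1 q.1 with h1 | h1 | h1
      · rw [Gr.proj_eq_zero h.monoG h1 w.2, TensorProduct.zero_tmul]
      · exact absurd (Prod.ext h1.symm (by omega)) hqp
      · rw [Gr.proj_eq_zero h.monoH (by omega : p.2 < q.2) u.2, TensorProduct.tmul_zero]
    · exact fun h => absurd hp h

lemma sum_triple {A : Type*} [AddCommMonoid A] (n : ℕ) (f : ℕ → ℕ → ℕ → A) :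
    ∑ p ∈ Finset.HasAntidiagonal.antidiagonal n, ∑ q ∈ Finset.HasAntidiagonal.antidiagonal p.1, f q.1 q.2 p.2 =
      ∑ p ∈ Finset.HasAntidiagonal.antidiagonal n, ∑ q ∈ Finset.HasAntidiagonal.antidiagonal p.2, f p.1 q.1 q.2 := by
  rw [Finset.sum_sigma', Finset.sum_sigma']
  refine Finset.sum_nbij' (fun x => ⟨(x.2.1, x.2.2 + x.1.2), (x.2.2, x.1.2)⟩)
    (fun x => ⟨(x.1.1 + x.2.1, x.2.2), (x.1.1, x.2.1)⟩) ?_ ?_ ?_ ?_ ?_ <;>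
  rintro ⟨⟨a, b⟩, ⟨c, d⟩⟩ <;> simp only [Finset.mem_sigma, Finset.HasAntidiagonal.mem_antidiagonal] <;>
  rintro ⟨h1, h2⟩ <;> subst h2 <;> simp_all <;> omega

/-- Coassociativity passes to the associated graded map. -/
lemma gr_coassoc {ψ : U →ₗ[k] U ⊗[k] U} {φ : V →ₗ[k] V ⊗[k] U} (hφ : IsFiltered F F H φ)
    (hψ : IsFiltered H H H ψ)
    (h : (TensorProduct.assoc k V U U).toLinearMap ∘ₗ φ.rTensor U ∘ₗ φ = ψ.lTensor V ∘ₗ φ) :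
    (TensorProduct.assoc k (Gr F) (Gr H) (Gr H)).toLinearMap ∘ₗ (grMap hφ).rTensor (Gr H) ∘ₗ
      grMap hφ = (grMap hψ).lTensor (Gr F) ∘ₗ grMap hφ := by
  refine Gr.hom_ext fun n x => ?_
  -- both sides as sums over `a + b + c = n`
  let P : ℕ → ℕ → ℕ → V ⊗[k] (U ⊗[k] U) →ₗ[k] Gr F ⊗[k] (Gr H ⊗[k] Gr H) := fun a b c =>
    TensorProduct.map (Gr.proj F a) (TensorProduct.map (Gr.proj H b) (Gr.proj H c))
  have hL : (TensorProduct.assoc k (Gr F) (Gr H) (Gr H)) ((grMap hφ).rTensor (Gr H)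
      (grMap hφ (Gr.of F n x))) = ∑ p ∈ Finset.HasAntidiagonal.antidiagonal n, ∑ q ∈ Finset.HasAntidiagonal.antidiagonal p.1,
        P q.1 q.2 p.2 (TensorProduct.assoc k V U U (φ.rTensor U (φ x))) := by
    have key : (Finset.HasAntidiagonal.antidiagonal n).sup (fun p => tens (F p.1) (H p.2)) ≤
        LinearMap.eqLocus
          ((TensorProduct.assoc k (Gr F) (Gr H) (Gr H)).toLinearMap ∘ₗ
            (grMap hφ).rTensor (Gr H) ∘ₗ ∑ p ∈ Finset.HasAntidiagonal.antidiagonal n,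
              TensorProduct.map (Gr.proj F p.1) (Gr.proj H p.2))
          (∑ p ∈ Finset.HasAntidiagonal.antidiagonal n, ∑ q ∈ Finset.HasAntidiagonal.antidiagonal p.1,
            P q.1 q.2 p.2 ∘ₗ (TensorProduct.assoc k V U U).toLinearMap ∘ₗ φ.rTensor U) := by
      refine Finset.sup_le fun r hr => tens_le fun v hv u hu => ?_
      rw [LinearMap.mem_eqLocus]
      simp only [LinearMap.comp_apply, LinearMap.sum_apply, map_sum]
      refine Finset.sum_congr rfl fun p hp => ?_
      rw [Finset.HasAntidiagonal.mem_antidiagonal] at hp hr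
      have e : ∀ y : V ⊗[k] U, ∑ q ∈ Finset.HasAntidiagonal.antidiagonal p.1,
          P q.1 q.2 p.2 (TensorProduct.assoc k V U U (y ⊗ₜ[k] u)) =
          TensorProduct.assoc k (Gr F) (Gr H) (Gr H) ((∑ q ∈ Finset.HasAntidiagonal.antidiagonal p.1,
            TensorProduct.map (Gr.proj F q.1) (Gr.proj H q.2) y) ⊗ₜ[k] Gr.proj H p.2 u) := by
        intro y
        rw [TensorProduct.sum_tmul, map_sum]
        refine Finset.sum_congr rfl fun q _ => ?_
        induction y with
        | zero => simp
        | add a b ha hb => simp only [map_add, TensorProduct.add_tmul, ha, hb]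
        | tmul a b => simp [P]
      simp only [LinearEquiv.coe_coe, LinearMap.rTensor_tmul, TensorProduct.map_tmul]
      rw [e (φ v)]
      have e2 : ∑ q ∈ Finset.HasAntidiagonal.antidiagonal p.1,
          TensorProduct.map (Gr.proj F q.1) (Gr.proj H q.2) (φ v) = grAux F H φ p.1 v := by
        simp [grAux]
      rw [e2]
      rcases lt_trichotomy r.1 p.1 with h1 | h1 | h1
      · rw [Gr.proj_eq_zero hφ.monoG h1 hv, hφ.grAux_eq_zero h1 hv, map_zero]
      · rw [← h1, Gr.proj_of_mem F r.1 hv, grMap_of]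
      · rw [Gr.proj_eq_zero hφ.monoH (by omega : r.2 < p.2) hu, TensorProduct.tmul_zero,
          TensorProduct.tmul_zero]
    have := key (hφ.map_mem n x x.2)
    rw [LinearMap.mem_eqLocus] at this
    simp only [LinearMap.comp_apply, LinearMap.sum_apply, map_sum, LinearEquiv.coe_coe] at this
    rw [grMap_of, grAux, LinearMap.comp_apply, LinearMap.sum_apply, map_sum, map_sum]
    exact this
  have hR : (grMap hψ).lTensor (Gr F) (grMap hφ (Gr.of F n x)) =
      ∑ p ∈ Finset.HasAntidiagonal.antidiagonal n, ∑ q ∈ Finset.HasAntidiagonal.antidiagonal p.2,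
        P p.1 q.1 q.2 (ψ.lTensor V (φ x)) := by
    have key : (Finset.HasAntidiagonal.antidiagonal n).sup (fun p => tens (F p.1) (H p.2)) ≤
        LinearMap.eqLocus
          ((grMap hψ).lTensor (Gr F) ∘ₗ ∑ p ∈ Finset.HasAntidiagonal.antidiagonal n,
              TensorProduct.map (Gr.proj F p.1) (Gr.proj H p.2))
          (∑ p ∈ Finset.HasAntidiagonal.antidiagonal n, ∑ q ∈ Finset.HasAntidiagonal.antidiagonal p.2,
            P p.1 q.1 q.2 ∘ₗ ψ.lTensor V) := by
      refine Finset.sup_le fun r hr => tens_le fun v hv u hu => ?_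
      rw [LinearMap.mem_eqLocus]
      simp only [LinearMap.comp_apply, LinearMap.sum_apply, map_sum]
      refine Finset.sum_congr rfl fun p hp => ?_
      rw [Finset.HasAntidiagonal.mem_antidiagonal] at hp hr
      simp only [LinearMap.lTensor_tmul, TensorProduct.map_tmul, P]
      have e2 : ∑ q ∈ Finset.HasAntidiagonal.antidiagonal p.2,
          TensorProduct.map (Gr.proj H q.1) (Gr.proj H q.2) (ψ u) = grAux H H ψ p.2 u := by
        simp [grAux]
      rw [← TensorProduct.tmul_sum, e2]
      rcases lt_trichotomy r.1 p.1 with h1 | h1 | h1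
      · rw [Gr.proj_eq_zero hφ.monoG h1 hv, TensorProduct.zero_tmul, TensorProduct.zero_tmul]
      · have h2 : r.2 = p.2 := by omega
        rw [← h2, Gr.proj_of_mem H r.2 hu, grMap_of]
      · have h2 : r.2 < p.2 := by omega
        rw [Gr.proj_eq_zero hψ.monoF h2 hu, hψ.grAux_eq_zero h2 hu, map_zero]
    have := key (hφ.map_mem n x x.2)
    rw [LinearMap.mem_eqLocus] at this
    simp only [LinearMap.comp_apply, LinearMap.sum_apply, map_sum] at this
    rw [grMap_of, grAux, LinearMap.comp_apply, LinearMap.sum_apply, map_sum]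
    exact this
  have h' := LinearMap.congr_fun h x
  simp only [LinearMap.comp_apply, LinearEquiv.coe_coe] at h' ⊢
  rw [hL, hR, ← h', sum_triple n fun a b c => P a b c _]

/-- The linear form on `gr U` given by the linear form `ε` on the component `H₀` and by zero on the
components of positive degree. -/
def grForm (H : ℕ → Submodule k U) (ε : U →ₗ[k] k) : Gr H →ₗ[k] k :=
  Gr.lift fun n =>
    match n with
    | 0 => ((prev H 0).submoduleOf (H 0)).liftQ (ε ∘ₗ (H 0).subtype) fun x hx => by
        have : (H 0).subtype x = 0 := hx
        rw [LinearMap.mem_ker, LinearMap.comp_apply, this, map_zero]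
    | _ + 1 => 0

lemma grForm_of_zero (ε : U →ₗ[k] k) (x : H 0) : grForm H ε (Gr.of H 0 x) = ε x := by
  rw [grForm, Gr.of, LinearMap.comp_apply]
  exact Gr.lift_lof _ 0 _

lemma grForm_of_succ (ε : U →ₗ[k] k) (n : ℕ) (x : H (n + 1)) :
    grForm H ε (Gr.of H (n + 1) x) = 0 := by
  rw [grForm, Gr.of, LinearMap.comp_apply]
  exact Gr.lift_lof _ (n + 1) _

lemma grForm_proj_succ (ε : U →ₗ[k] k) (n : ℕ) (x : U) :
    grForm H ε (Gr.proj H (n + 1) x) = 0 := by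
  rw [grForm, Gr.proj, LinearMap.comp_apply]
  exact Gr.lift_lof _ (n + 1) _

/-- The counit law passes to the associated graded map. -/
lemma gr_counit_right {φ : V →ₗ[k] V ⊗[k] U} (hφ : IsFiltered F F H φ) {ε : U →ₗ[k] k}
    (h : (TensorProduct.rid k V).toLinearMap ∘ₗ ε.lTensor V ∘ₗ φ = LinearMap.id) :
    (TensorProduct.rid k (Gr F)).toLinearMap ∘ₗ (grForm H ε).lTensor (Gr F) ∘ₗ grMap hφ =
      LinearMap.id := by
  refine Gr.hom_ext fun n x => ?_
  have key : (Finset.HasAntidiagonal.antidiagonal n).sup (fun p => tens (F p.1) (H p.2)) ≤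
      LinearMap.eqLocus
        ((TensorProduct.rid k (Gr F)).toLinearMap ∘ₗ (grForm H ε).lTensor (Gr F) ∘ₗ
          ∑ p ∈ Finset.HasAntidiagonal.antidiagonal n, TensorProduct.map (Gr.proj F p.1) (Gr.proj H p.2))
        (Gr.proj F n ∘ₗ (TensorProduct.rid k V).toLinearMap ∘ₗ ε.lTensor V) := by
    refine Finset.sup_le fun r hr => tens_le fun v hv u hu => ?_
    rw [Finset.HasAntidiagonal.mem_antidiagonal] at hr
    rw [LinearMap.mem_eqLocus]
    simp only [LinearMap.comp_apply, LinearMap.sum_apply, map_sum, LinearEquiv.coe_coe,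
      TensorProduct.map_tmul, LinearMap.lTensor_tmul, TensorProduct.rid_tmul, map_smul]
    rw [Finset.sum_eq_single (n, 0)]
    · rcases Nat.eq_zero_or_pos r.2 with h0 | h0
      · rw [h0] at hu
        rw [Gr.proj_of_mem H 0 hu, grForm_of_zero]
      · rw [Gr.proj_eq_zero hφ.monoF (by omega : r.1 < n) hv, smul_zero, smul_zero]
    · rintro ⟨i, j⟩ hp hne
      rw [Finset.HasAntidiagonal.mem_antidiagonal] at hp
      cases j with
      | zero => exact absurd (by simpa using hp) hne
      | succ j => rw [grForm_proj_succ, zero_smul]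
    · intro h0
      exact absurd (by simp) h0
  have h1 := key (hφ.map_mem n x x.2)
  have h2 := LinearMap.congr_fun h x
  rw [LinearMap.mem_eqLocus] at h1
  simp only [LinearMap.comp_apply, LinearEquiv.coe_coe, LinearMap.id_apply] at h1 h2 ⊢
  rw [grMap_of, grAux, LinearMap.comp_apply, h1, h2, Gr.proj_coe]

/-- The left counit law passes to the associated graded map. -/
lemma gr_counit_left {ψ : U →ₗ[k] U ⊗[k] U} (hψ : IsFiltered H H H ψ) {ε : U →ₗ[k] k}
    (h : (TensorProduct.lid k U).toLinearMap ∘ₗ ε.rTensor U ∘ₗ ψ = LinearMap.id) :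
    (TensorProduct.lid k (Gr H)).toLinearMap ∘ₗ (grForm H ε).rTensor (Gr H) ∘ₗ grMap hψ =
      LinearMap.id := by
  refine Gr.hom_ext fun n x => ?_
  have key : (Finset.HasAntidiagonal.antidiagonal n).sup (fun p => tens (H p.1) (H p.2)) ≤
      LinearMap.eqLocus
        ((TensorProduct.lid k (Gr H)).toLinearMap ∘ₗ (grForm H ε).rTensor (Gr H) ∘ₗ
          ∑ p ∈ Finset.HasAntidiagonal.antidiagonal n, TensorProduct.map (Gr.proj H p.1) (Gr.proj H p.2))
        (Gr.proj H n ∘ₗ (TensorProduct.lid k U).toLinearMap ∘ₗ ε.rTensor U) := by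
    refine Finset.sup_le fun r hr => tens_le fun v hv u hu => ?_
    rw [Finset.HasAntidiagonal.mem_antidiagonal] at hr
    rw [LinearMap.mem_eqLocus]
    simp only [LinearMap.comp_apply, LinearMap.sum_apply, map_sum, LinearEquiv.coe_coe,
      TensorProduct.map_tmul, LinearMap.rTensor_tmul, TensorProduct.lid_tmul, map_smul]
    rw [Finset.sum_eq_single (0, n)]
    · rcases Nat.eq_zero_or_pos r.1 with h0 | h0
      · rw [h0] at hv
        rw [Gr.proj_of_mem H 0 hv, grForm_of_zero]
      · rw [Gr.proj_eq_zero hψ.monoF (by omega : r.2 < n) hu, smul_zero, smul_zero]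
    · rintro ⟨i, j⟩ hp hne
      rw [Finset.HasAntidiagonal.mem_antidiagonal] at hp
      cases i with
      | zero => exact absurd (by simpa using hp) hne
      | succ i => rw [grForm_proj_succ, zero_smul]
    · intro h0
      exact absurd (by simp) h0
  have h1 := key (hψ.map_mem n x x.2)
  have h2 := LinearMap.congr_fun h x
  rw [LinearMap.mem_eqLocus] at h1
  simp only [LinearMap.comp_apply, LinearEquiv.coe_coe, LinearMap.id_apply] at h1 h2 ⊢
  rw [grMap_of, grAux, LinearMap.comp_apply, h1, h2, Gr.proj_coe]

end Filtered

section CoradicalFiltration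

variable {k C : Type*} [Field k] [AddCommGroup C] [Module k C] [Coalgebra k C]
  {M : Type*} [AddCommGroup M] [Module k M] [RightComodule k C M]

/-- A wedge-type condition in degrees summing to `n + 1` gives `∑_{i+j=n} Fᵢ ⊗ Hⱼ`. -/
lemma mem_sup_tens {V W : Type*} [AddCommGroup V] [Module k V] [AddCommGroup W] [Module k W]
    {F : ℕ → Submodule k V} {H : ℕ → Submodule k W} (hF : Monotone F) (n : ℕ) {x : V ⊗[k] W}
    (h : ∀ a b, a + b = n + 1 → x ∈ tens (prev F a) ⊤ ⊔ tens ⊤ (prev H b)) :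
    x ∈ (Finset.HasAntidiagonal.antidiagonal n).sup fun p => tens (F p.1) (H p.2) := by
  classical
  have hr : ∀ a, ∃ r : V →ₗ[k] V, (∀ v, r v ∈ prev F a) ∧ ∀ v ∈ prev F a, r v = v := fun a => by
    obtain ⟨r, hr⟩ := (prev F a).subtype.exists_leftInverse_of_injective (by simp)
    refine ⟨(prev F a).subtype ∘ₗ r, fun v => (r v).2, fun v hv => ?_⟩
    have : r v = ⟨v, hv⟩ := LinearMap.congr_fun hr ⟨v, hv⟩
    rw [LinearMap.comp_apply, this, Submodule.subtype_apply]
  choose r hr1 hr2 using hr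
  have hr0 : r 0 = 0 := LinearMap.ext fun v => by simpa [prev] using hr1 0 v
  have hx : x = ∑ i ∈ Finset.range (n + 1), (r (i + 1) - r i).rTensor W x := by
    have e : ∀ i, (r (i + 1) - r i).rTensor W x = (r (i + 1)).rTensor W x - (r i).rTensor W x :=
      fun i => by rw [LinearMap.rTensor_sub, LinearMap.sub_apply]
    simp only [e]
    rw [Finset.sum_range_sub (fun i => (r i).rTensor W x), hr0]
    have h1 : tens (prev F (n + 1)) ⊤ ⊔ tens ⊤ (prev H 0) ≤
        LinearMap.eqLocus ((r (n + 1)).rTensor W) LinearMap.id := by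
      refine sup_le (tens_le fun v hv w _ => ?_) (tens_le fun v _ w hw => ?_)
      · rw [LinearMap.mem_eqLocus, LinearMap.rTensor_tmul, hr2 _ v hv, LinearMap.id_apply]
      · have : w = 0 := hw
        rw [this, TensorProduct.tmul_zero]
        exact zero_mem _
    have h2 := h1 (h (n + 1) 0 rfl)
    rw [LinearMap.mem_eqLocus, LinearMap.id_apply] at h2
    rw [h2, LinearMap.rTensor_zero, LinearMap.zero_apply, sub_zero]
  rw [hx]
  refine Submodule.sum_mem _ fun i hi => ?_
  rw [Finset.mem_range] at hi
  have hmem : (i, n - i) ∈ Finset.HasAntidiagonal.antidiagonal n := by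
    rw [Finset.HasAntidiagonal.mem_antidiagonal]
    omega
  refine (Finset.le_sup (f := fun p : ℕ × ℕ => tens (F p.1) (H p.2)) hmem) ?_
  have h1 : tens (prev F i) ⊤ ⊔ tens ⊤ (prev H (n - i + 1)) ≤
      (tens (F i) (H (n - i))).comap ((r (i + 1) - r i).rTensor W) := by
    refine sup_le (tens_le fun v hv w _ => ?_) (tens_le fun v _ w hw => ?_)
    · rw [Submodule.mem_comap, LinearMap.rTensor_tmul, LinearMap.sub_apply, hr2 i v hv,
        hr2 (i + 1) v (prev_le hF i hv), sub_self, TensorProduct.zero_tmul]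
      exact zero_mem _
    · rw [Submodule.mem_comap, LinearMap.rTensor_tmul]
      exact tmul_mem_tens (Submodule.sub_mem _ (hr1 (i + 1) v) (prev_le hF i (hr1 i v))) hw
  exact h1 (h i (n - i + 1) (by omega))

/-- An ascending filtration of a comodule by subcomodules with `ρ(F₀) ⊆ M ⊗ C₀` and
`ρ(Fₙ₊₁) ⊆ Fₙ ⊗ C + M ⊗ C₀` satisfies `ρ(Fₙ) ⊆ ∑_{i+j=n} Fᵢ ⊗ Cⱼ`. -/
lemma coact_mem_of_filtration {F : ℕ → Submodule k M} (hF : Monotone F)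
    (hsub : ∀ n, IsSubcomodule k C (F n))
    (h : ∀ n, ∀ m ∈ F n, ρ k C M m ∈ tens (prev F n) ⊤ ⊔ tens ⊤ (coradical k C))
    (n : ℕ) (m : M) (hm : m ∈ F n) :
    ρ k C M m ∈ (Finset.HasAntidiagonal.antidiagonal n).sup
      fun p => tens (F p.1) (coradicalFiltration k C p.2) := by
  have hsub' : ∀ n, IsSubcomodule k C (prev F n) := fun n => by
    cases n with
    | zero => exact isSubcomodule_bot
    | succ n => exact hsub n
  have key : ∀ b a, ∀ m ∈ prev F (a + b),
      ρ k C M m ∈ tens (prev F a) ⊤ ⊔ tens ⊤ (prev (coradicalFiltration k C) b) := by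
    intro b
    induction b with
    | zero => exact fun a m hm => Submodule.mem_sup_left (hsub' a m hm)
    | succ b ih =>
      cases b with
      | zero => exact fun a m hm => h a m hm
      | succ b =>
        intro a m hm
        refine mem_sup_of_ctrL fun f hf => ?_
        change coeff k C f m ∈ wedge k (coradicalFiltration k C b) (coradical k C)
        rw [wedge, Submodule.mem_comap, comul_coeff]
        have h1 : tens (prev F (a + (b + 1))) ⊤ ⊔ tens ⊤ (coradical k C) ≤
            (tens (coradicalFiltration k C b) ⊤ ⊔ tens ⊤ (coradical k C)).comap
              ((coeff k C f).rTensor C) := by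
          refine sup_le (tens_le fun v hv c _ => ?_) (tens_le fun v _ c hc => ?_)
          · exact Submodule.mem_sup_left
              (tmul_mem_tens (ctrL_mem_of_mem_sup (ih a v hv) hf) trivial)
          · exact Submodule.mem_sup_right (tmul_mem_tens trivial hc)
        exact h1 (h (a + (b + 1)) m hm)
  refine mem_sup_tens hF n fun a b hab => key b a m ?_
  rw [hab]
  exact hm

lemma isSubcoalgebra_coradical : IsSubcoalgebra k C (coradical k C) := by
  change coradical k C ≤ (tens (coradical k C) (coradical k C)).comap (Coalgebra.comul (R := k))
  exact sSup_le fun D hD d hd => tens_mono (le_sSup hD) (le_sSup hD) (hD.1 d hd)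

lemma isSubcomodule_coradical : IsSubcomodule k C (coradical k C) := fun d hd =>
  tens_mono le_rfl le_top (isSubcoalgebra_coradical d hd)

lemma isSubcomodule_coradicalFiltration (n : ℕ) :
    IsSubcomodule k C (coradicalFiltration k C n) := by
  cases n with
  | zero => exact isSubcomodule_coradical
  | succ n =>
    rw [isSubcomodule_iff]
    intro g c hc
    change Coalgebra.comul (R := k) (act k C C g c) ∈
      tens (coradicalFiltration k C n) ⊤ ⊔ tens ⊤ (coradical k C)
    have h1 : Coalgebra.comul (R := k) (act k C C g c) =
        (act k C C g).lTensor C (Coalgebra.comul (R := k) c) := coact_act g c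
    rw [h1]
    have h2 : tens (coradicalFiltration k C n) ⊤ ⊔ tens ⊤ (coradical k C) ≤
        (tens (coradicalFiltration k C n) ⊤ ⊔ tens ⊤ (coradical k C)).comap
          ((act k C C g).lTensor C) := by
      refine sup_le (tens_le fun v hv c _ => ?_) (tens_le fun v _ c hc => ?_)
      · exact Submodule.mem_sup_left (tmul_mem_tens hv trivial)
      · exact Submodule.mem_sup_right
          (tmul_mem_tens trivial (isSubcomodule_iff.1 isSubcomodule_coradical g c hc))
    exact h2 hc

lemma coradicalFiltration_mono : Monotone (coradicalFiltration k C) :=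
  monotone_nat_of_le_succ fun n c hc =>
    Submodule.mem_sup_left (isSubcomodule_coradicalFiltration n c hc)

/-- The coradical filtration is a coalgebra filtration. -/
lemma isFiltered_comul : IsFiltered (coradicalFiltration k C) (coradicalFiltration k C)
    (coradicalFiltration k C) (Coalgebra.comul (R := k) (A := C)) where
  monoF := coradicalFiltration_mono
  monoG := coradicalFiltration_mono
  monoH := coradicalFiltration_mono
  map_mem := by
    refine coact_mem_of_filtration (k := k) (M := C) coradicalFiltration_mono
      isSubcomodule_coradicalFiltration ?_
    rintro (_ | n) m hm
    · exact Submodule.mem_sup_right (tens_mono le_top le_rfl (isSubcoalgebra_coradical m hm))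
    · exact hm

lemma isSubcomodule_loewySeries (n : ℕ) : IsSubcomodule k C (loewySeries k C M n) :=
  (loewyAux k C M n).2

lemma loewySeries_mono : Monotone (loewySeries k C M) :=
  monotone_nat_of_le_succ fun n m hm => by
    let _ := (loewyAux k C M n).2.quotient
    change (loewyAux k C M n).1.mkQ m ∈ socle k C (M ⧸ (loewyAux k C M n).1)
    have : (loewyAux k C M n).1.mkQ m = 0 := by
      rw [Submodule.mkQ_apply, Submodule.Quotient.mk_eq_zero]
      exact hm
    rw [this]
    exact zero_mem _

/-- `ρ(Mₙ) ⊆ ∑_{i+j=n} Mᵢ ⊗ Cⱼ` for the Loewy series of a comodule `M`. -/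
lemma isFiltered_coact : IsFiltered (loewySeries k C M) (loewySeries k C M)
    (coradicalFiltration k C) (ρ k C M) where
  monoF := loewySeries_mono
  monoG := loewySeries_mono
  monoH := coradicalFiltration_mono
  map_mem := coact_mem_of_filtration loewySeries_mono isSubcomodule_loewySeries
    fun n m hm => by
      cases n with
      | zero => exact Submodule.mem_sup_right (coact_mem_of_mem_socle hm)
      | succ n =>
        let _ := (loewyAux k C M n).2.quotient
        exact mem_sup_of_mkQ (N := loewySeries k C M n)
          (coact_mem_of_mem_socle (M := M ⧸ (loewyAux k C M n).1) hm)

end CoradicalFiltration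

noncomputable section Graded

variable (k C : Type*) [Field k] [AddCommGroup C] [Module k C] [Coalgebra k C]

/-- The graded space `gr C = ⨁ₙ Cₙ / Cₙ₋₁` of the coradical filtration of `C`. -/
abbrev GrCoalgebra : Type _ := Gr (coradicalFiltration k C)

/-- The graded coalgebra `gr C`: its comultiplication is induced by that of `C`, and its counit is
`ε` on `C₀` and zero in positive degrees. -/
instance grCoalgebra : Coalgebra k (GrCoalgebra k C) where
  comul := grMap isFiltered_comul
  counit := grForm (coradicalFiltration k C) Coalgebra.counit
  coassoc := gr_coassoc isFiltered_comul isFiltered_comul Coalgebra.coassoc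
  rTensor_counit_comp_comul := by
    have := gr_counit_left (isFiltered_comul (k := k) (C := C)) (ε := Coalgebra.counit) (by
      rw [Coalgebra.rTensor_counit_comp_comul]
      ext c
      simp)
    refine LinearMap.ext fun x => (TensorProduct.lid k (GrCoalgebra k C)).injective ?_
    simpa using LinearMap.congr_fun this x
  lTensor_counit_comp_comul := by
    have := gr_counit_right (isFiltered_comul (k := k) (C := C)) (ε := Coalgebra.counit) (by
      rw [Coalgebra.lTensor_counit_comp_comul]
      ext c
      simp)
    refine LinearMap.ext fun x => (TensorProduct.rid k (GrCoalgebra k C)).injective ?_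
    simpa using LinearMap.congr_fun this x

/-- The graded space `gr M = ⨁ₙ Mₙ / Mₙ₋₁` of the Loewy series of a right `C`-comodule `M`. -/
abbrev GrComodule (M : Type*) [AddCommGroup M] [Module k M] [RightComodule k C M] : Type _ :=
  Gr (loewySeries k C M)

/-- The graded right `gr C`-comodule `gr M`, with structure map induced by that of `M`. -/
instance grComodule (M : Type*) [AddCommGroup M] [Module k M] [RightComodule k C M] :
    RightComodule k (GrCoalgebra k C) (GrComodule k C M) where
  coact := grMap isFiltered_coact
  coassoc := gr_coassoc isFiltered_coact isFiltered_comul RightComodule.coassoc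
  counit := gr_counit_right isFiltered_coact RightComodule.counit

variable {k C} in
/-- A simple right `C`-comodule `S` as a right `gr C`-comodule: since `ρ(S) ⊆ S ⊗ C₀`, the
composition of `ρ` with the inclusion of `C₀ = gr C(0)` in `gr C` is a structure map. -/
@[reducible] def IsSimpleComodule.grComodule {S : Type*} [AddCommGroup S] [Module k S]
    [RightComodule k C S] (hS : IsSimpleComodule k C S) :
    RightComodule k (GrCoalgebra k C) S where
  coact := (Gr.proj (coradicalFiltration k C) 0).lTensor S ∘ₗ ρ k C S
  coassoc := by
    set π := Gr.proj (coradicalFiltration k C) 0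
    refine LinearMap.ext fun s => ?_
    have hs : ρ k C S s ∈ tens ⊤ (coradical k C) :=
      coact_mem_of_mem_socle (by rw [hS.socle_eq_top]; trivial)
    have h1 : (TensorProduct.assoc k S (GrCoalgebra k C) (GrCoalgebra k C)).toLinearMap ∘ₗ
        (π.lTensor S ∘ₗ ρ k C S).rTensor (GrCoalgebra k C) ∘ₗ π.lTensor S =
        (TensorProduct.map π π).lTensor S ∘ₗ (TensorProduct.assoc k S C C).toLinearMap ∘ₗ
          (ρ k C S).rTensor C := by
      refine TensorProduct.ext' fun t c => ?_
      simp only [LinearMap.comp_apply, LinearMap.lTensor_tmul, LinearMap.rTensor_tmul,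
        LinearEquiv.coe_coe]
      generalize ρ k C S t = y
      induction y with
      | zero => simp
      | tmul a b => simp
      | add a b ha hb => simp only [map_add, TensorProduct.add_tmul, ha, hb]
    have h2 : tens ⊤ (coradical k C) ≤ LinearMap.eqLocus
        ((TensorProduct.map π π).lTensor S ∘ₗ (Coalgebra.comul (R := k) (A := C)).lTensor S)
        ((Coalgebra.comul (R := k) (A := GrCoalgebra k C)).lTensor S ∘ₗ π.lTensor S) := by
      refine tens_le fun t _ c hc => ?_
      have h3 : Coalgebra.comul (R := k) (π c) = TensorProduct.map π π (Coalgebra.comul c) := by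
        change grMap isFiltered_comul (Gr.proj (coradicalFiltration k C) 0 c) = _
        rw [Gr.proj_of_mem _ 0 hc, grMap_of, grAux]
        simp [π]
      rw [LinearMap.mem_eqLocus]
      simp only [LinearMap.comp_apply, LinearMap.lTensor_tmul, h3]
    have h1' := LinearMap.congr_fun h1 (ρ k C S s)
    have h2' := h2 hs
    rw [LinearMap.mem_eqLocus] at h2'
    simp only [LinearMap.comp_apply, LinearEquiv.coe_coe] at h1' h2' ⊢
    rw [h1', coassoc_apply, h2']
  counit := by
    refine LinearMap.ext fun s => ?_
    have hs : ρ k C S s ∈ tens ⊤ (coradical k C) :=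
      coact_mem_of_mem_socle (by rw [hS.socle_eq_top]; trivial)
    have h2 : tens ⊤ (coradical k C) ≤ LinearMap.eqLocus
        ((Coalgebra.counit (R := k) (A := GrCoalgebra k C)).lTensor S ∘ₗ
          (Gr.proj (coradicalFiltration k C) 0).lTensor S)
        ((Coalgebra.counit (R := k) (A := C)).lTensor S) := by
      refine tens_le fun t _ c hc => ?_
      have h3 : Coalgebra.counit (R := k) (Gr.proj (coradicalFiltration k C) 0 c) =
          Coalgebra.counit (R := k) c := by
        change grForm _ _ (Gr.proj (coradicalFiltration k C) 0 c) = _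
        rw [Gr.proj_of_mem _ 0 hc, grForm_of_zero]
      rw [LinearMap.mem_eqLocus]
      simp only [LinearMap.comp_apply, LinearMap.lTensor_tmul, h3]
    have h2' := h2 hs
    rw [LinearMap.mem_eqLocus] at h2'
    have h4 := LinearMap.congr_fun (RightComodule.counit (k := k) (C := C) (M := S)) s
    simp only [LinearMap.comp_apply, LinearEquiv.coe_coe] at h2' h4 ⊢
    rw [h2', h4]

end Graded

section Injective

variable (k C : Type u) [Field k] [AddCommGroup C] [Module k C] [Coalgebra k C]

/-- `E` is an injective object of the category of right `C`-comodules. -/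
def IsInjectiveComodule (E : Type u) [AddCommGroup E] [Module k E] [RightComodule k C E] : Prop :=
  ∀ (X Y : Type u) [AddCommGroup X] [Module k X] [RightComodule k C X]
    [AddCommGroup Y] [Module k Y] [RightComodule k C Y] (i : X →ₗ[k] Y) (f : X →ₗ[k] E),
    IsComoduleHom k C i → Function.Injective i → IsComoduleHom k C f →
      ∃ g : Y →ₗ[k] E, IsComoduleHom k C g ∧ g ∘ₗ i = f

/-- `j : S → E` is an injective envelope of the right `C`-comodule `S`: it is an injective
morphism into an injective comodule, and it is essential, i.e. every nonzero subcomodule of `E`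
meets its image nontrivially. -/
structure IsInjectiveEnvelope {S E : Type u} [AddCommGroup S] [Module k S] [RightComodule k C S]
    [AddCommGroup E] [Module k E] [RightComodule k C E] (j : S →ₗ[k] E) : Prop where
  isComoduleHom : IsComoduleHom k C j
  injective : Function.Injective j
  isInjectiveComodule : IsInjectiveComodule k C E
  essential : ∀ P : Submodule k E, IsSubcomodule k C P → P ≠ ⊥ → P ⊓ LinearMap.range j ≠ ⊥

end Injective

end CoalgGr

open CoalgGr

namespace CoalgGr

/-! ### Cyclic subcomodules, simple subcomodules, and the socle of the regular comodule -/

section Socle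

variable {k C : Type*} [Field k] [AddCommGroup C] [Module k C] [Coalgebra k C]
  {M N : Type*} [AddCommGroup M] [Module k M] [RightComodule k C M]
  [AddCommGroup N] [Module k N] [RightComodule k C N]

/-! The key is the intrinsic description `Mₙ = ρ⁻¹(M ⊗ Cₙ)` of the Loewy series
(`mem_loewySeries_iff`). For `n = 0` (`mem_socle_iff`) the new inclusion holds because `ρ` embeds
`M` into `M ⊗ C`, a sum of copies of `C`, and `C₀` lies in the socle of `C` (`coradical_le_socle`),
so the preimage of `M ⊗ C₀` is semisimple. The general case is an induction that embeds `M / Mₙ`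
into `M ⊗ C / Cₙ`. Two consequences give the theorem.

Injectivity. Every comodule morphism preserves Loewy series, and the Loewy series of `C` is its
coradical filtration, so `gr` is functorial (`grMap_map`) and takes `C` to `gr C`. A suitable
coefficient map embeds the envelope `E` of a simple comodule into `C`, and injectivity of `E` splits
it (`IsInjectiveEnvelope.exists_retract`). Hence `gr E` is a retract of `gr C`, and a coalgebra is
injective over itself (`isInjectiveComodule_regular`).

Essentiality. If `e` lies in `M_N` but not in `M_{N-1}`, then `ρ(e)` is not in `M ⊗ C_{N-1}`, so
some linear form on `C` that vanishes on `C_{N-1}` acts on `e` with nonzero result in `M₀`. The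
induced form of degree `N` on `gr C` kills all components of degree below `N`. Acting on an element
of `gr M` with leading term `e`, it yields a nonzero element of degree zero
(`exists_mem_of_isSubcomodule_gr`). For `M = E` the degree-zero part is the socle of `E`, which is
the image of `S` (`IsInjectiveEnvelope.loewySeries_zero`).

The isomorphism with any other envelope is the usual uniqueness argument
(`IsInjectiveEnvelope.exists_equiv`). -/

lemma act_counit (m : M) : act k C M Coalgebra.counit m = m :=
  LinearMap.congr_fun (RightComodule.counit (k := k) (C := C) (M := M)) m

/-- The form `h ∘ₗ act k C C g` is the convolution product of `h` and `g`, so this is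
coassociativity read as associativity of the action of the dual algebra. It makes the set of all
`act k C M g m` a subcomodule. -/
lemma act_act (g h : C →ₗ[k] k) (m : M) :
    act k C M h (act k C M g m) = act k C M (h ∘ₗ act k C C g) m := by
  change ctrR h (ρ k C M (act k C M g m)) = _
  rw [coact_act]
  change _ = ctrR (h ∘ₗ act k C C g) (ρ k C M m)
  simp only [ctrR, LinearMap.comp_apply, LinearMap.lTensor_comp_apply]

lemma coact_injective : Function.Injective (ρ k C M) := by
  refine (injective_iff_map_eq_zero _).2 fun m hm => ?_
  rw [← act_counit (k := k) (C := C) m, act, LinearMap.comp_apply, hm, map_zero]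

/-- The subcomodule generated by an element. -/
def cyclicSubcomodule (k C : Type*) [Field k] [AddCommGroup C] [Module k C] [Coalgebra k C]
    {M : Type*} [AddCommGroup M] [Module k M] [RightComodule k C M] (m : M) : Submodule k M :=
  LinearMap.range ((LinearMap.applyₗ (ρ k C M m) : (M ⊗[k] C →ₗ[k] M) →ₗ[k] M) ∘ₗ
    ({ toFun := ctrR
       map_add' := fun g h => TensorProduct.ext' fun m c => by simp [add_smul]
       map_smul' := fun a g => TensorProduct.ext' fun m c => by simp [mul_smul] } :
      (C →ₗ[k] k) →ₗ[k] (M ⊗[k] C →ₗ[k] M)))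

lemma mem_cyclicSubcomodule {m x : M} :
    x ∈ cyclicSubcomodule k C m ↔ ∃ g : C →ₗ[k] k, act k C M g m = x :=
  Iff.rfl

lemma self_mem_cyclicSubcomodule (m : M) : m ∈ cyclicSubcomodule k C m :=
  mem_cyclicSubcomodule.2 ⟨_, act_counit m⟩

lemma isSubcomodule_cyclicSubcomodule (m : M) :
    IsSubcomodule k C (cyclicSubcomodule k C m) := by
  rw [isSubcomodule_iff]
  rintro h _ ⟨g, rfl⟩
  exact mem_cyclicSubcomodule.2 ⟨_, (act_act g h m).symm⟩

lemma cyclicSubcomodule_le {P : Submodule k M} (hP : IsSubcomodule k C P) {m : M} (hm : m ∈ P) :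
    cyclicSubcomodule k C m ≤ P := by
  rintro _ ⟨g, rfl⟩
  exact isSubcomodule_iff.1 hP g m hm

/-- Comodules are locally finite. -/
lemma finiteDimensional_cyclicSubcomodule (m : M) :
    FiniteDimensional k (cyclicSubcomodule k C m) := by
  -- A tensor is a finite sum of pure tensors, and all its contractions lie in the span of the
  -- finitely many left factors.
  have key : ∀ y : M ⊗[k] C, ∃ W : Submodule k M, FiniteDimensional k W ∧
      ∀ g : C →ₗ[k] k, ctrR g y ∈ W := by
    intro y
    induction y with
    | zero => exact ⟨⊥, inferInstance, fun g => by simp⟩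
    | tmul a c =>
      refine ⟨k ∙ a, inferInstance, fun g => ?_⟩
      rw [ctrR_tmul]
      exact Submodule.smul_mem _ _ (Submodule.mem_span_singleton_self a)
    | add a b ha hb =>
      obtain ⟨W, hW, h1⟩ := ha
      obtain ⟨W', hW', h2⟩ := hb
      refine ⟨W ⊔ W', inferInstance, fun g => ?_⟩
      rw [map_add]
      exact Submodule.add_mem_sup (h1 g) (h2 g)
  obtain ⟨W, hW, h⟩ := key (ρ k C M m)
  have hle : cyclicSubcomodule k C m ≤ W := by
    rintro _ ⟨g, rfl⟩
    exact h g
  exact Submodule.finiteDimensional_of_le hle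

/-- Every nonzero comodule contains a simple subcomodule. -/
lemma exists_isSimpleSubcomodule_le {P : Submodule k M} (hP : IsSubcomodule k C P) (h0 : P ≠ ⊥) :
    ∃ T ≤ P, IsSimpleSubcomodule k C T := by
  obtain ⟨m, hm, hm0⟩ := Submodule.exists_mem_ne_zero_of_ne_bot h0
  set Z := cyclicSubcomodule k C m
  have hfin : FiniteDimensional k Z := finiteDimensional_cyclicSubcomodule m
  -- A nonzero subcomodule of least dimension inside a finite-dimensional one is simple.
  obtain ⟨T, ⟨hTZ, hT, hT0⟩, hmin⟩ := exists_minimalFor_of_wellFoundedLT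
    (fun T : Submodule k M => T ≤ Z ∧ IsSubcomodule k C T ∧ T ≠ ⊥) (fun T => Module.finrank k T)
    ⟨Z, le_rfl, isSubcomodule_cyclicSubcomodule m, fun h =>
      hm0 ((Submodule.mem_bot k).1 (h ▸ self_mem_cyclicSubcomodule m))⟩
  refine ⟨T, hTZ.trans (cyclicSubcomodule_le hP hm), hT, hT0, fun Q hQT hQ => ?_⟩
  by_cases h : Q = ⊥
  · exact Or.inl h
  have : FiniteDimensional k T := Submodule.finiteDimensional_of_le hTZ
  exact Or.inr (Submodule.eq_of_le_of_finrank_le hQT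
    (hmin ⟨hQT.trans hTZ, hQ, h⟩ (Submodule.finrank_mono hQT)))

/-- Comodule morphisms map the socle into the socle. -/
lemma IsComoduleHom.map_socle {f : M →ₗ[k] N} (hf : IsComoduleHom k C f) :
    (socle k C M).map f ≤ socle k C N := by
  rw [Submodule.map_le_iff_le_comap]
  refine sSup_le fun T hT => ?_
  rw [← Submodule.map_le_iff_le_comap]
  by_cases h0 : T.map f = ⊥
  · rw [h0]
    exact bot_le
  refine le_sSup ⟨hf.map hT.1, h0, fun Q hQ hQs => ?_⟩
  rcases hT.2.2 (T ⊓ Q.comap f) inf_le_left (hT.1.inf (hf.comap hQs)) with h | h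
  · left
    rw [eq_bot_iff]
    intro q hq
    obtain ⟨t, ht, rfl⟩ := hQ hq
    have : t ∈ (⊥ : Submodule k M) := h ▸ ⟨ht, hq⟩
    rw [(Submodule.mem_bot k).1 this, map_zero]
    exact zero_mem _
  · right
    exact le_antisymm hQ (Submodule.map_le_iff_le_comap.2 (inf_eq_left.1 h))

/-- The coradical of `C` lies in the socle of `C` as a right comodule. -/
lemma coradical_le_socle : coradical k C ≤ socle k C C := by
  refine sSup_le fun D hD => ?_
  have hDs : IsSubcomodule k C D := fun d hd => tens_mono le_rfl le_top (hD.1 d hd)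
  -- The left tensor factor stays in the intersection because both spaces are right subcomodules.
  -- For the right factor, coefficient maps of `C` are comodule endomorphisms and so preserve the
  -- socle. Simplicity of `D` then leaves only `0` or `D`, and `0` is excluded by a simple
  -- subcomodule of `D`.
  have hX : IsSubcoalgebra k C (D ⊓ socle k C C) := by
    intro d hd
    refine mem_tens_of_mem_of_mem (hDs.inf isSubcomodule_socle d hd) ?_
    refine mem_tens_right_of_ctrL fun f => ⟨ctrL_mem (tens_mono le_top le_rfl (hD.1 d hd.1)) f, ?_⟩
    exact (coeff_hom f).map_socle ⟨d, hd.2, rfl⟩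
  obtain ⟨T, hTD, hT⟩ := exists_isSimpleSubcomodule_le hDs hD.2.1
  rcases hD.2.2 _ inf_le_left hX with h | h
  · exact absurd (le_bot_iff.1 (h ▸ le_inf hTD (le_sSup hT))) hT.2.1
  · exact inf_eq_left.1 h

end Socle

/-! ### Stable subspaces and equivariant maps over an algebra given by generators -/

section Semisimple

variable {k V V' X R : Type*} [Field k] [AddCommGroup V] [Module k V] [AddCommGroup V'] [Module k V']
  [Ring R] [Algebra k R] [Module R V] [IsScalarTower k R V] [Module R V'] [IsScalarTower k R V']
  {x : X → R}

/-- A subspace stable under algebra generators of `R` is an `R`-submodule. -/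
lemma exists_restrictScalars_eq (hx : Algebra.adjoin k (Set.range x) = ⊤) {P : Submodule k V}
    (hP : ∀ g, ∀ m ∈ P, x g • m ∈ P) : ∃ Q : Submodule R V, Q.restrictScalars k = P := by
  refine ⟨{ P with smul_mem' := fun r m hm => ?_ }, rfl⟩
  have hr : r ∈ Algebra.adjoin k (Set.range x) := hx ▸ Algebra.mem_top
  change r • m ∈ P
  induction hr using Algebra.adjoin_induction generalizing m with
  | mem r hr =>
    obtain ⟨g, rfl⟩ := hr
    exact hP g m hm
  | algebraMap a =>
    rw [algebraMap_smul]
    exact P.smul_mem a hm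
  | add r s _ _ hr hs =>
    rw [add_smul]
    exact add_mem (hr m hm) (hs m hm)
  | mul r s _ _ hr hs =>
    rw [mul_smul]
    exact hr _ (hs m hm)

/-- A linear map commuting with algebra generators of `R` is `R`-linear. -/
lemma exists_linearMap_eq (hx : Algebra.adjoin k (Set.range x) = ⊤) (f : V →ₗ[k] V')
    (hf : ∀ g m, f (x g • m) = x g • f m) : ∃ F : V →ₗ[R] V', ∀ m, F m = f m := by
  refine ⟨{ f with map_smul' := fun r m => ?_ }, fun m => rfl⟩
  have hr : r ∈ Algebra.adjoin k (Set.range x) := hx ▸ Algebra.mem_top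
  change f (r • m) = r • f m
  induction hr using Algebra.adjoin_induction generalizing m with
  | mem r hr =>
    obtain ⟨g, rfl⟩ := hr
    exact hf g m
  | algebraMap a => rw [algebraMap_smul, algebraMap_smul, map_smul]
  | add r s _ _ hr hs => rw [add_smul, add_smul, map_add, hr, hs]
  | mul r s _ _ hr hs => rw [mul_smul, mul_smul, hr, hs]

end Semisimple

/-! ### The socle through semisimple modules -/

section SocleSemisimple

variable {k C : Type*} [Field k] [AddCommGroup C] [Module k C] [Coalgebra k C]
  {M : Type*} [AddCommGroup M] [Module k M] [RightComodule k C M]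
  {R : Type*} [Ring R] [Algebra k R] [Module R M] [IsScalarTower k R M]
  {x : (C →ₗ[k] k) → R}

/-- The generators `x g` of `R` act as the forms `g` do, and subcomodules are the subspaces stable
under these. No relations among the generators are required, so `R` may be a free algebra. -/
lemma isSubcomodule_restrictScalars (hM : ∀ g (m : M), x g • m = act k C M g m)
    (Q : Submodule R M) : IsSubcomodule k C (Q.restrictScalars k) := by
  rw [isSubcomodule_iff]
  intro g m hm
  rw [← hM]
  exact Q.smul_mem _ hm

/-- Simple subcomodules are the simple submodules over a `k`-algebra generated by the forms on
`C`. -/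
lemma isSimpleSubcomodule_restrictScalars_iff (hx : Algebra.adjoin k (Set.range x) = ⊤)
    (hM : ∀ g (m : M), x g • m = act k C M g m) {Q : Submodule R M} :
    IsSimpleSubcomodule k C (Q.restrictScalars k) ↔ IsSimpleModule R Q := by
  rw [isSimpleModule_iff_isAtom, isAtom_iff_le_of_ge]
  constructor
  · rintro ⟨_, h0, h⟩
    refine ⟨fun h' => h0 (by simp [h']), fun Q' hQ' hle => ?_⟩
    rcases h (Q'.restrictScalars k) hle (isSubcomodule_restrictScalars hM Q') with h1 | h1
    · exact absurd (by simpa using h1) hQ'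
    · exact (Submodule.restrictScalars_injective k R M h1).ge
  · rintro ⟨h0, h⟩
    refine ⟨isSubcomodule_restrictScalars hM Q, by simpa using h0, fun P hP hPs => ?_⟩
    obtain ⟨Q', rfl⟩ := exists_restrictScalars_eq (R := R) hx (P := P) fun g m hm => by
      rw [hM]
      exact isSubcomodule_iff.1 hPs g m hm
    by_cases h1 : Q' = ⊥
    · left
      simp [h1]
    · exact Or.inr (le_antisymm hP (h Q' h1 hP))

/-- The socle of a comodule as a semisimple module. -/
lemma exists_isSemisimpleModule_restrictScalars_eq_socle
    (hx : Algebra.adjoin k (Set.range x) = ⊤) (hM : ∀ g (m : M), x g • m = act k C M g m) :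
    ∃ Q : Submodule R M, Q.restrictScalars k = socle k C M ∧ IsSemisimpleModule R Q := by
  refine ⟨sSup {Q : Submodule R M | IsSimpleModule R Q}, le_antisymm ?_ (sSup_le fun T hT => ?_), ?_⟩
  -- Turning the socle into an `R`-submodule `Q'` allows the supremum to be bounded among
  -- `R`-submodules, without commuting it with restriction of scalars.
  · obtain ⟨Q', hQ'⟩ := exists_restrictScalars_eq (R := R) hx (P := socle k C M) fun g m hm => by
      rw [hM]
      exact isSubcomodule_iff.1 isSubcomodule_socle g m hm
    rw [← hQ']
    change sSup {Q : Submodule R M | IsSimpleModule R Q} ≤ Q'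
    refine sSup_le fun Q hQ => ?_
    change Q.restrictScalars k ≤ Q'.restrictScalars k
    rw [hQ']
    exact le_sSup ((isSimpleSubcomodule_restrictScalars_iff hx hM).2 hQ)
  · obtain ⟨Q, rfl⟩ := exists_restrictScalars_eq (R := R) hx (P := T) fun g m hm => by
      rw [hM]
      exact isSubcomodule_iff.1 hT.1 g m hm
    exact le_sSup (α := Submodule R M) ((isSimpleSubcomodule_restrictScalars_iff hx hM).1 hT)
  · rw [sSup_eq_iSup]
    refine isSemisimpleModule_biSup_of_isSemisimpleModule_submodule fun Q hQ => ?_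
    have : IsSimpleModule R Q := hQ
    infer_instance

/-- A semisimple module is the sum of its simple submodules, and those of `Q` are simple
subcomodules of `M`. -/
lemma mem_socle_of_isSemisimpleModule
    (hx : Algebra.adjoin k (Set.range x) = ⊤) (hM : ∀ g (m : M), x g • m = act k C M g m)
    {Q : Submodule R M} [IsSemisimpleModule R Q] {m : M} (hm : m ∈ Q) : m ∈ socle k C M := by
  obtain ⟨Q', hQ', _⟩ := exists_isSemisimpleModule_restrictScalars_eq_socle (R := R) (M := M) hx hM
  have h : (⊤ : Submodule R Q) ≤ Q'.comap Q.subtype := by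
    rw [← IsSemisimpleModule.sSup_simples_eq_top R Q]
    refine sSup_le fun T (hT : IsSimpleModule R T) => ?_
    rw [← Submodule.map_le_iff_le_comap]
    have : IsSimpleModule R (T.map Q.subtype) :=
      IsSimpleModule.congr (Submodule.equivMapOfInjective Q.subtype Q.injective_subtype T).symm
    change (T.map Q.subtype).restrictScalars k ≤ Q'.restrictScalars k
    rw [hQ']
    exact le_sSup ((isSimpleSubcomodule_restrictScalars_iff hx hM).2 this)
  rw [← hQ']
  exact h (x := ⟨m, hm⟩) trivial

/-- After swapping the factors, `ρ` is an injective `R`-linear map from `M` to `C ⊗ M`, with `R`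
acting on `C`. It suffices that the image of `m` lies in a semisimple submodule, since its preimage
is then semisimple too. -/
lemma mem_socle_of_coact_mem_aux [Module R C] [IsScalarTower k R C]
    (hx : Algebra.adjoin k (Set.range x) = ⊤) (hM : ∀ g (m : M), x g • m = act k C M g m)
    (hC : ∀ g (c : C), x g • c = act k C C g c)
    {m : M} (h : ρ k C M m ∈ tens ⊤ (coradical k C)) : m ∈ socle k C M := by
  obtain ⟨Q, hQ, _⟩ := exists_isSemisimpleModule_restrictScalars_eq_socle (R := R) (M := C) hx hC
  -- Each `v` gives an `R`-linear copy `c ↦ c ⊗ v` of `C`. The module `W` below is the sum of the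
  -- images of the socle of `C` in these copies.
  have hmk : ∀ v : M, ∃ F : C →ₗ[R] C ⊗[k] M, ∀ c, F c = (TensorProduct.mk k C M).flip v c :=
    fun v => exists_linearMap_eq hx _ fun g c => by simp [TensorProduct.smul_tmul']
  choose F hF using hmk
  have hT : ∀ g (t : M ⊗[k] C), TensorProduct.comm k M C ((act k C C g).lTensor M t) =
      x g • TensorProduct.comm k M C t := by
    intro g t
    induction t with
    | zero => simp
    | tmul a b => simp [TensorProduct.smul_tmul', hC]
    | add a b ha hb => simp only [map_add, smul_add, ha, hb]
  obtain ⟨φ, hφ⟩ := exists_linearMap_eq (R := R) hx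
    ((TensorProduct.comm k M C).toLinearMap ∘ₗ ρ k C M) fun g m => by
      simp only [LinearMap.comp_apply, LinearEquiv.coe_coe, hM, coact_act, hT]
  set W : Submodule R (C ⊗[k] M) := ⨆ v ∈ (Set.univ : Set M), Q.map (F v)
  have hW : IsSemisimpleModule R W := by
    refine isSemisimpleModule_biSup_of_isSemisimpleModule_submodule fun v _ => ?_
    rw [← LinearMap.range_domRestrict]
    exact IsSemisimpleModule.range _
  have hle : tens ⊤ (coradical k C) ≤
      (W.restrictScalars k).comap (TensorProduct.comm k M C).toLinearMap := by
    refine tens_le fun v _ c hc => ?_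
    refine (le_biSup (fun v => Q.map (F v)) (Set.mem_univ v)) ⟨c, ?_, hF v c⟩
    change c ∈ Q.restrictScalars k
    rw [hQ]
    exact coradical_le_socle hc
  have hss : IsSemisimpleModule R (W.comap φ) := by
    refine IsSemisimpleModule.of_injective (φ.restrict (p := W.comap φ) (q := W) fun _ h => h) ?_
    intro a b hab
    have h1 : φ a = φ b := congrArg Subtype.val hab
    rw [hφ, hφ] at h1
    exact Subtype.ext (coact_injective (k := k) (C := C)
      ((TensorProduct.comm k M C).injective h1))
  refine mem_socle_of_isSemisimpleModule hx hM (Q := W.comap φ) ?_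
  rw [Submodule.mem_comap, hφ]
  exact hle h

end SocleSemisimple

/-! ### The Loewy series as preimages of the coradical filtration -/

section Loewy

variable {k C : Type*} [Field k] [AddCommGroup C] [Module k C] [Coalgebra k C]
  {M N : Type*} [AddCommGroup M] [Module k M] [RightComodule k C M]
  [AddCommGroup N] [Module k N] [RightComodule k C N]

/-- The socle of `M` is `ρ⁻¹(M ⊗ C₀)`. -/
lemma mem_socle_iff {m : M} : m ∈ socle k C M ↔ ρ k C M m ∈ tens ⊤ (coradical k C) := by
  refine ⟨coact_mem_of_mem_socle, fun h => ?_⟩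
  -- Only the action of the generators matters, so the free algebra on the dual space replaces the
  -- convolution algebra.
  let R := FreeAlgebra k (C →ₗ[k] k)
  let aM : R →ₐ[k] Module.End k M := FreeAlgebra.lift k (act k C M)
  let aC : R →ₐ[k] Module.End k C := FreeAlgebra.lift k (act k C C)
  let _ : Module R M := Module.compHom M aM.toRingHom
  let _ : Module R C := Module.compHom C aC.toRingHom
  have hM : ∀ (r : R) (m : M), r • m = aM r m := fun _ _ => rfl
  have hC : ∀ (r : R) (m : C), r • m = aC r m := fun _ _ => rfl
  have : IsScalarTower k R M := ⟨fun a r m => by simp only [hM, map_smul, LinearMap.smul_apply]⟩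
  have : IsScalarTower k R C := ⟨fun a r m => by simp only [hC, map_smul, LinearMap.smul_apply]⟩
  refine mem_socle_of_coact_mem_aux (R := R) (x := FreeAlgebra.ι k) (FreeAlgebra.adjoin_range_ι k _)
    (fun g m => ?_) (fun g m => ?_) h
  · rw [hM]
    exact LinearMap.congr_fun (FreeAlgebra.lift_ι_apply _ g) m
  · rw [hC]
    exact LinearMap.congr_fun (FreeAlgebra.lift_ι_apply _ g) m

/-- Contraction with linear forms on `M` reduces exactness after tensoring to the quotient map of
`V` itself. -/
lemma lTensor_mkQ_eq_zero_iff {V : Type*} [AddCommGroup V] [Module k V] {P : Submodule k V}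
    {y : M ⊗[k] V} : P.mkQ.lTensor M y = 0 ↔ y ∈ tens ⊤ P := by
  constructor
  · intro h
    refine mem_tens_right_of_ctrL fun f => ?_
    have h1 : P.mkQ ∘ₗ ctrL f = ctrL f ∘ₗ P.mkQ.lTensor M := TensorProduct.ext' fun m c => by simp
    have h2 := LinearMap.congr_fun h1 y
    rw [LinearMap.comp_apply, LinearMap.comp_apply, h, map_zero] at h2
    exact (Submodule.Quotient.mk_eq_zero _).1 h2
  · have : tens ⊤ P ≤ LinearMap.ker (P.mkQ.lTensor M) := tens_le fun m _ v hv => by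
      have : P.mkQ v = 0 := by simpa using hv
      rw [LinearMap.mem_ker, LinearMap.lTensor_tmul, this, TensorProduct.tmul_zero]
    exact fun h => this h

lemma coact_mem_loewySeries {n : ℕ} {m : M} (hm : m ∈ loewySeries k C M n) :
    ρ k C M m ∈ tens ⊤ (coradicalFiltration k C n) := by
  have : (Finset.HasAntidiagonal.antidiagonal n).sup
      (fun p => tens (loewySeries k C M p.1) (coradicalFiltration k C p.2)) ≤
      tens ⊤ (coradicalFiltration k C n) :=
    Finset.sup_le fun p hp => tens_mono le_top
      (coradicalFiltration_mono (by rw [Finset.HasAntidiagonal.mem_antidiagonal] at hp; omega))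
  exact this (isFiltered_coact.map_mem n m hm)

/-- The terms of the Loewy series of `M` are the subspaces `ρ⁻¹(M ⊗ Cₙ)`. -/
lemma mem_loewySeries_iff {n : ℕ} {m : M} :
    m ∈ loewySeries k C M n ↔ ρ k C M m ∈ tens ⊤ (coradicalFiltration k C n) := by
  refine ⟨coact_mem_loewySeries, ?_⟩
  induction n generalizing m with
  | zero => exact mem_socle_iff.2
  | succ n ih =>
    intro h
    let _ := (loewyAux k C M n).2.quotient
    set P := loewySeries k C M n
    change (loewyAux k C M n).1.mkQ m ∈ socle k C (M ⧸ (loewyAux k C M n).1)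
    rw [mem_socle_iff]
    change P.mkQ.rTensor C (ρ k C M m) ∈ _
    set Cn := coradicalFiltration k C n
    -- `M / Mₙ` embeds into `M ⊗ C / Cₙ`
    let q : M →ₗ[k] M ⊗[k] (C ⧸ Cn) := Cn.mkQ.lTensor M ∘ₗ ρ k C M
    have hq0 : ∀ v ∈ P, q v = 0 := fun v hv => lTensor_mkQ_eq_zero_iff.2 (coact_mem_loewySeries hv)
    have hq1 : ∀ v, q v = 0 → v ∈ P := fun v hv => ih (lTensor_mkQ_eq_zero_iff.1 hv)
    let i : (M ⧸ P) →ₗ[k] M ⊗[k] (C ⧸ Cn) := P.liftQ q hq0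
    -- A linear left inverse of the embedding suffices: it touches only the first tensor factor,
    -- while membership in `tens ⊤ (coradical k C)` constrains only the second.
    obtain ⟨r, hr⟩ := i.exists_leftInverse_of_injective (by
      refine LinearMap.ker_eq_bot'.2 fun y hy => ?_
      obtain ⟨v, rfl⟩ := P.mkQ_surjective y
      exact (Submodule.Quotient.mk_eq_zero _).2 (hq1 v hy))
    have e1 : P.mkQ.rTensor C (ρ k C M m) = (r ∘ₗ q).rTensor C (ρ k C M m) := by
      congr 2
      exact LinearMap.ext fun v => (LinearMap.congr_fun hr (P.mkQ v)).symm
    have e2 : q.rTensor C (ρ k C M m) ∈ tens ⊤ (coradical k C) := by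
      -- By coassociativity the question moves to `Δ` on the second factor of `ρ(m)`. There `Δ(Cₙ₊₁)
      -- ⊆ Cₙ ⊗ C + C ⊗ C₀` becomes `C / Cₙ ⊗ C₀` modulo `Cₙ`.
      have h1 : q.rTensor C (ρ k C M m) =
          (TensorProduct.assoc k M (C ⧸ Cn) C).symm ((Cn.mkQ.rTensor C).lTensor M
            ((Coalgebra.comul (R := k) (A := C)).lTensor M (ρ k C M m))) := by
        rw [← coassoc_apply, LinearEquiv.eq_symm_apply, LinearMap.rTensor_comp_apply]
        generalize (ρ k C M).rTensor C (ρ k C M m) = y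
        have : (TensorProduct.assoc k M (C ⧸ Cn) C).toLinearMap ∘ₗ (Cn.mkQ.lTensor M).rTensor C =
            (Cn.mkQ.rTensor C).lTensor M ∘ₗ (TensorProduct.assoc k M C C).toLinearMap :=
          TensorProduct.ext_threefold fun m c d => by simp
        exact LinearMap.congr_fun this y
      rw [h1]
      have h2 : tens ⊤ (coradicalFiltration k C (n + 1)) ≤ (tens ⊤ (coradical k C)).comap
          ((TensorProduct.assoc k M (C ⧸ Cn) C).symm.toLinearMap ∘ₗ (Cn.mkQ.rTensor C).lTensor M ∘ₗ
            (Coalgebra.comul (R := k) (A := C)).lTensor M) := by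
        refine tens_le fun v _ c hc => ?_
        have h3 : Cn.mkQ.rTensor C (Coalgebra.comul c) ∈ tens ⊤ (coradical k C) :=
          mkQ_mem_of_mem_sup hc
        have h4 : tens ⊤ (coradical k C) ≤ (tens ⊤ (coradical k C)).comap
            ((TensorProduct.assoc k M (C ⧸ Cn) C).symm.toLinearMap ∘ₗ
              TensorProduct.mk k M ((C ⧸ Cn) ⊗[k] C) v) :=
          tens_le fun a _ b hb => by
            simpa using tmul_mem_tens (Submodule.mem_top (x := v ⊗ₜ[k] a)) hb
        exact h4 h3
      exact h2 h
    rw [e1, LinearMap.rTensor_comp_apply]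
    exact map_mem_tens (f := r) (g := LinearMap.id) (N' := ⊤) (fun _ _ => trivial)
      (fun v hv => hv) e2

/-- This is the left counit law. Together with naturality of coefficients it makes every comodule
morphism `f` into `C` the coefficient map of `ε ∘ f`, which is why `C` is injective. -/
lemma coeff_counit (c : C) : coeff k C (Coalgebra.counit (R := k) (A := C)) c = c := by
  have h := LinearMap.congr_fun (Coalgebra.rTensor_counit_comp_comul (R := k) (A := C)) c
  simp only [LinearMap.comp_apply] at h
  refine (congrArg (TensorProduct.lid k C) h).trans ?_
  simp

/-- The Loewy series of the regular comodule is the coradical filtration. -/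
lemma mem_coradicalFiltration_iff {n : ℕ} {c : C} : c ∈ coradicalFiltration k C n ↔
    Coalgebra.comul (R := k) c ∈ tens ⊤ (coradicalFiltration k C n) := by
  constructor
  · intro hc
    have : (Finset.HasAntidiagonal.antidiagonal n).sup
        (fun p => tens (coradicalFiltration k C p.1) (coradicalFiltration k C p.2)) ≤
        tens ⊤ (coradicalFiltration k C n) :=
      Finset.sup_le fun p hp => tens_mono le_top
        (coradicalFiltration_mono (by rw [Finset.HasAntidiagonal.mem_antidiagonal] at hp; omega))
    exact this (isFiltered_comul.map_mem n c hc)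
  · intro h
    -- Contracting the first factor of `Δ(c)` with the counit recovers `c`.
    have h1 := ctrL_mem h Coalgebra.counit
    have h2 : ctrL Coalgebra.counit (Coalgebra.comul (R := k) c) = c := coeff_counit c
    rwa [h2] at h1

/-- With `D = Cₙ` and `mem_loewySeries_iff`, this shows that comodule morphisms preserve Loewy
series. -/
lemma IsComoduleHom.coact_mem_tens {f : M →ₗ[k] N} (hf : IsComoduleHom k C f) {D : Submodule k C}
    {m : M} (hm : ρ k C M m ∈ tens ⊤ D) : ρ k C N (f m) ∈ tens ⊤ D := by
  have := LinearMap.congr_fun hf m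
  simp only [LinearMap.comp_apply] at this
  rw [this]
  exact map_mem_tens (f := f) (g := LinearMap.id) (N' := ⊤) (fun _ _ => trivial) (fun v hv => hv) hm

end Loewy

/-! ### Functoriality of graded spaces, leading terms, and homogeneous linear forms -/

noncomputable section GradedMaps

variable {k V V' U W : Type*} [Field k] [AddCommGroup V] [Module k V] [AddCommGroup V'] [Module k V']
  [AddCommGroup U] [Module k U] [AddCommGroup W] [Module k W]
  {F : ℕ → Submodule k V} {F' : ℕ → Submodule k V'} {H : ℕ → Submodule k U} {G : ℕ → Submodule k W}

/-- The map of graded spaces induced by a linear map that preserves filtrations. -/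
def Gr.map (f : V →ₗ[k] V') (hf : ∀ n, ∀ x ∈ F n, f x ∈ F' n) : Gr F →ₗ[k] Gr F' :=
  Gr.lift fun n => ((prev F n).submoduleOf (F n)).liftQ (Gr.of F' n ∘ₗ f.restrict (hf n))
    fun x hx => by
      refine Gr.of_eq_zero ?_
      cases n with
      | zero =>
        have : (x : V) = 0 := hx
        simp [this]
      | succ n => exact hf n x hx

lemma Gr.map_of (f : V →ₗ[k] V') (hf : ∀ n, ∀ x ∈ F n, f x ∈ F' n) (n : ℕ) (x : F n) :
    Gr.map f hf (Gr.of F n x) = Gr.of F' n ⟨f x, hf n x x.2⟩ := by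
  rw [Gr.map, Gr.of, LinearMap.comp_apply]
  exact Gr.lift_lof _ n _

/-- This makes `gr` a functor: a filtered morphism of comodules induces a morphism of the graded
comodules. -/
lemma grMap_map {φ : V →ₗ[k] V ⊗[k] U} {φ' : V' →ₗ[k] V' ⊗[k] U} (hφ : IsFiltered F F H φ)
    (hφ' : IsFiltered F' F' H φ') {f : V →ₗ[k] V'} (hf : ∀ n, ∀ x ∈ F n, f x ∈ F' n)
    (h : φ' ∘ₗ f = f.rTensor U ∘ₗ φ) :
    grMap hφ' ∘ₗ Gr.map f hf = (Gr.map f hf).rTensor (Gr H) ∘ₗ grMap hφ := by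
  refine Gr.hom_ext fun n x => ?_
  rw [LinearMap.comp_apply, LinearMap.comp_apply, Gr.map_of, grMap_of, grMap_of, grAux, grAux,
    LinearMap.comp_apply, LinearMap.comp_apply]
  have h' : φ' (f x) = f.rTensor U (φ x) := LinearMap.congr_fun h x
  simp only [h']
  have key : (Finset.HasAntidiagonal.antidiagonal n).sup (fun p => tens (F p.1) (H p.2)) ≤
      LinearMap.eqLocus
        ((∑ p ∈ Finset.HasAntidiagonal.antidiagonal n,
          TensorProduct.map (Gr.proj F' p.1) (Gr.proj H p.2)) ∘ₗ f.rTensor U)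
        ((Gr.map f hf).rTensor (Gr H) ∘ₗ ∑ p ∈ Finset.HasAntidiagonal.antidiagonal n,
          TensorProduct.map (Gr.proj F p.1) (Gr.proj H p.2)) := by
    refine Finset.sup_le fun r hr => tens_le fun v hv u hu => ?_
    rw [LinearMap.mem_eqLocus]
    simp only [LinearMap.comp_apply, LinearMap.sum_apply, map_sum, LinearMap.rTensor_tmul,
      TensorProduct.map_tmul]
    refine Finset.sum_congr rfl fun p hp => ?_
    rw [Finset.HasAntidiagonal.mem_antidiagonal] at hp hr
    -- The maps `Gr.proj` are arbitrary linear extensions, so they are controlled only on the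
    -- filtration. As `r` and `p` have the same sum, whenever they differ one of the two factors
    -- lies too low and projects to zero.
    rcases lt_trichotomy r.1 p.1 with h1 | h1 | h1
    · rw [Gr.proj_eq_zero hφ.monoG h1 hv, Gr.proj_eq_zero hφ'.monoG h1 (hf _ _ hv), map_zero]
    · rw [← h1, Gr.proj_of_mem F r.1 hv, Gr.proj_of_mem F' r.1 (hf _ _ hv), Gr.map_of]
    · rw [Gr.proj_eq_zero hφ.monoH (by omega : r.2 < p.2) hu, TensorProduct.tmul_zero,
        TensorProduct.tmul_zero]
  exact key (hφ.map_mem n x x.2)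

/-- The denominator in degree zero is `F₋₁ = 0`. -/
lemma Gr.of_zero_injective : Function.Injective (Gr.of F 0) := by
  have h1 : Function.Injective (Gr.lof F 0) := DirectSum.of_injective 0
  have h2 : Function.Injective ((prev F 0).submoduleOf (F 0)).mkQ := by
    rw [← LinearMap.ker_eq_bot, Submodule.ker_mkQ]
    exact Submodule.ker_subtype (F 0)
  exact h1.comp h2

/-- The part of the graded space of degrees less than `N`. -/
def Gr.lower (F : ℕ → Submodule k V) : ℕ → Submodule k (Gr F)
  | 0 => ⊥
  | N + 1 => Gr.lower F N ⊔ LinearMap.range (Gr.of F N)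

lemma Gr.lower_mono : Monotone (Gr.lower F) :=
  monotone_nat_of_le_succ fun _ => le_sup_left

lemma Gr.lower_le {N : ℕ} {P : Submodule k (Gr F)} (h : ∀ n < N, ∀ x, Gr.of F n x ∈ P) :
    Gr.lower F N ≤ P := by
  induction N with
  | zero => exact bot_le
  | succ N ih =>
    refine sup_le (ih fun n hn => h n (hn.trans N.lt_succ_self)) ?_
    rintro _ ⟨x, rfl⟩
    exact h N N.lt_succ_self x

lemma Gr.exists_mem_lower (x : Gr F) : ∃ N, x ∈ Gr.lower F N := by
  refine DirectSum.induction_on (motive := fun x : Gr F => ∃ N, x ∈ Gr.lower F N) x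
    ⟨0, zero_mem _⟩ (fun n y => ?_) (fun x y hx hy => ?_)
  · obtain ⟨x, rfl⟩ := Submodule.Quotient.mk_surjective _ y
    exact ⟨n + 1, Submodule.mem_sup_right ⟨x, rfl⟩⟩
  · obtain ⟨a, ha⟩ := hx
    obtain ⟨b, hb⟩ := hy
    exact ⟨max a b, add_mem (Gr.lower_mono (le_max_left a b) ha)
      (Gr.lower_mono (le_max_right a b) hb)⟩

/-- Every nonzero element of the graded space has a component of highest degree. -/
lemma Gr.exists_leading {x : Gr F} (hx : x ≠ 0) :
    ∃ N, ∃ e : F N, (e : V) ∉ prev F N ∧ ∃ y ∈ Gr.lower F N, x = y + Gr.of F N e := by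
  classical
  have hex := Gr.exists_mem_lower x
  obtain ⟨N, hN⟩ : ∃ N, Nat.find hex = N + 1 := by
    refine Nat.exists_eq_succ_of_ne_zero fun h0 => hx ?_
    have := Nat.find_spec hex
    rw [h0] at this
    exact this
  have hmem := Nat.find_spec hex
  rw [hN] at hmem
  obtain ⟨y, hy, _, ⟨e, rfl⟩, rfl⟩ := Submodule.mem_sup.1 hmem
  refine ⟨N, e, fun he => ?_, y, hy, rfl⟩
  -- If the class of `e` were zero, the element would already lie in `Gr.lower F N`, against the
  -- minimality of `N + 1`.
  refine Nat.find_min hex (m := N) (by omega) ?_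
  rw [Gr.of_eq_zero he, add_zero]
  exact hy

/-- The linear form on the graded space, concentrated in degree `N`, induced by a linear form
that vanishes on `H_{N-1}`. -/
def formOfDegree (H : ℕ → Submodule k U) (N : ℕ) (h : U →ₗ[k] k) (h0 : ∀ u ∈ prev H N, h u = 0) :
    Gr H →ₗ[k] k :=
  Gr.lift fun n => if hn : n = N then
    ((prev H n).submoduleOf (H n)).liftQ (h ∘ₗ (H n).subtype) fun x hx => h0 x (hn ▸ hx) else 0

variable {N : ℕ} {h : U →ₗ[k] k} {h0 : ∀ u ∈ prev H N, h u = 0}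

lemma formOfDegree_of (u : H N) : formOfDegree H N h h0 (Gr.of H N u) = h u := by
  rw [formOfDegree, Gr.of, LinearMap.comp_apply]
  refine (Gr.lift_lof _ N _).trans ?_
  rw [dif_pos rfl]
  rfl

lemma formOfDegree_proj_of_ne {n : ℕ} (hn : n ≠ N) (u : U) :
    formOfDegree H N h h0 (Gr.proj H n u) = 0 := by
  rw [formOfDegree, Gr.proj, LinearMap.comp_apply]
  refine (Gr.lift_lof _ n _).trans ?_
  rw [dif_neg hn]
  rfl

variable {φ : V →ₗ[k] W ⊗[k] U}

lemma ctrR_map_proj_of_ne {p : ℕ × ℕ} (hp : p.2 ≠ N) (y : W ⊗[k] U) :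
    ctrR (formOfDegree H N h h0)
      (TensorProduct.map (Gr.proj G p.1) (Gr.proj H p.2) y) = 0 := by
  induction y with
  | zero => simp
  | add a b ha hb => rw [map_add, map_add, ha, hb, add_zero]
  | tmul w u => rw [TensorProduct.map_tmul, ctrR_tmul, formOfDegree_proj_of_ne hp, zero_smul]

/-- The second tensor factors have degree at most `n`, and the form lives in degree `N > n`. -/
lemma ctrR_formOfDegree_of_lt (hφ : IsFiltered F G H φ) {n : ℕ} (hn : n < N) (x : F n) :
    ctrR (formOfDegree H N h h0) (grMap hφ (Gr.of F n x)) = 0 := by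
  rw [grMap_of, grAux, LinearMap.comp_apply, LinearMap.sum_apply, map_sum]
  refine Finset.sum_eq_zero fun p hp => ctrR_map_proj_of_ne ?_ _
  rw [Finset.HasAntidiagonal.mem_antidiagonal] at hp
  omega

/-- In `Gᵢ ⊗ H_{N-i}` with `i > 0` the second factor lies in `H_{N-1}`, where `h` vanishes. Only `G₀
⊗ H_N` contributes. -/
lemma ctrR_mem_zero (hφ : IsFiltered F G H φ) (h0 : ∀ u ∈ prev H N, h u = 0) {x : V}
    (hx : x ∈ F N) : ctrR h (φ x) ∈ G 0 := by
  have key : (Finset.HasAntidiagonal.antidiagonal N).sup (fun p => tens (G p.1) (H p.2)) ≤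
      (G 0).comap (ctrR h) := by
    refine Finset.sup_le fun r hr => tens_le fun w hw u hu => ?_
    rw [Finset.HasAntidiagonal.mem_antidiagonal] at hr
    rw [Submodule.mem_comap, ctrR_tmul]
    rcases Nat.eq_zero_or_pos r.1 with h1 | h1
    · exact Submodule.smul_mem _ _ (h1 ▸ hw)
    · rw [h0 u (le_prev hφ.monoH (by omega) hu), zero_smul]
      exact zero_mem _
  exact key (hφ.map_mem N x hx)

/-- A form of degree `N` sees only the bidegree `(0, N)`, so contracting with it in the graded space
is contracting with `h` before passing to classes. -/
lemma ctrR_formOfDegree_of (hφ : IsFiltered F G H φ) (x : F N) :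
    ctrR (formOfDegree H N h h0) (grMap hφ (Gr.of F N x)) =
      Gr.of G 0 ⟨ctrR h (φ x), ctrR_mem_zero hφ h0 x.2⟩ := by
  rw [grMap_of, grAux, LinearMap.comp_apply, LinearMap.sum_apply, map_sum,
    Finset.sum_eq_single (0, N), ← Gr.proj_of_mem]
  · have key : (Finset.HasAntidiagonal.antidiagonal N).sup (fun p => tens (G p.1) (H p.2)) ≤
        LinearMap.eqLocus (ctrR (formOfDegree H N h h0) ∘ₗ
          TensorProduct.map (Gr.proj G 0) (Gr.proj H N)) (Gr.proj G 0 ∘ₗ ctrR h) := by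
      refine Finset.sup_le fun r hr => tens_le fun w hw u hu => ?_
      rw [Finset.HasAntidiagonal.mem_antidiagonal] at hr
      have hu' : u ∈ H N := hφ.monoH (by omega) hu
      rw [LinearMap.mem_eqLocus, LinearMap.comp_apply, LinearMap.comp_apply, TensorProduct.map_tmul,
        ctrR_tmul, ctrR_tmul, Gr.proj_of_mem H N hu', formOfDegree_of, map_smul]
    exact key (hφ.map_mem N x x.2)
  · rintro ⟨i, j⟩ hp hne
    refine ctrR_map_proj_of_ne (fun hj => hne ?_) _
    rw [Finset.HasAntidiagonal.mem_antidiagonal] at hp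
    simp only at hp hj
    rw [Prod.mk.injEq]
    omega
  · exact fun h => absurd (by simp) h

end GradedMaps

/-! ### Subcomodules of `gr M` and simplicity over `gr C` -/

section Hom

variable {k C : Type*} [Field k] [AddCommGroup C] [Module k C] [Coalgebra k C]
  {M N L : Type*} [AddCommGroup M] [Module k M] [RightComodule k C M]
  [AddCommGroup N] [Module k N] [RightComodule k C N]
  [AddCommGroup L] [Module k L] [RightComodule k C L]

lemma IsComoduleHom.comp {g : N →ₗ[k] L} {f : M →ₗ[k] N} (hg : IsComoduleHom k C g)
    (hf : IsComoduleHom k C f) : IsComoduleHom k C (g ∘ₗ f) := by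
  rw [IsComoduleHom] at *
  rw [← LinearMap.comp_assoc, hg, LinearMap.comp_assoc, hf, ← LinearMap.comp_assoc,
    ← LinearMap.rTensor_comp]

lemma isComoduleHom_id : IsComoduleHom k C (LinearMap.id : M →ₗ[k] M) := by
  rw [IsComoduleHom, LinearMap.rTensor_id, LinearMap.comp_id, LinearMap.id_comp]

lemma IsComoduleHom.isSubcomodule_ker {f : M →ₗ[k] N} (hf : IsComoduleHom k C f) :
    IsSubcomodule k C (LinearMap.ker f) :=
  hf.comap isSubcomodule_bot

lemma IsComoduleHom.isSubcomodule_range {f : M →ₗ[k] N} (hf : IsComoduleHom k C f) :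
    IsSubcomodule k C (LinearMap.range f) := by
  rw [LinearMap.range_eq_map]
  exact hf.map fun m _ => mem_tens_top _

lemma IsComoduleHom.coeff {f : M →ₗ[k] N} (hf : IsComoduleHom k C f) (g : N →ₗ[k] k) (m : M) :
    coeff k C g (f m) = coeff k C (g ∘ₗ f) m := by
  have h1 : ρ k C N (f m) = f.rTensor C (ρ k C M m) := LinearMap.congr_fun hf m
  simp only [CoalgGr.coeff, ctrL, LinearMap.comp_apply, h1, LinearMap.rTensor_comp_apply]

/-- In degree zero this is injectivity of `ρ`, since `M₋₁ = 0` and `C₋₁ = 0`. In higher degrees it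
is `mem_loewySeries_iff`. -/
lemma not_mem_loewySeries_prev {n : ℕ} {m : M} (hm : m ∉ prev (loewySeries k C M) n) :
    ρ k C M m ∉ tens ⊤ (prev (coradicalFiltration k C) n) := by
  intro h
  cases n with
  | zero =>
    have h0 : tens (⊤ : Submodule k M) (⊥ : Submodule k C) ≤ ⊥ := tens_le fun m _ c hc => by
      rw [(Submodule.mem_bot k).1 hc, TensorProduct.tmul_zero]
      exact zero_mem _
    refine hm ((Submodule.mem_bot k).2 (coact_injective (k := k) (C := C) ?_))
    rw [map_zero]
    exact h0 h
  | succ n => exact hm (mem_loewySeries_iff.2 h)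

/-- A nonzero subcomodule of `gr M` contains a nonzero element of degree zero. -/
lemma exists_mem_of_isSubcomodule_gr {P : Submodule k (GrComodule k C M)}
    (hP : IsSubcomodule k (GrCoalgebra k C) P) (h0 : P ≠ ⊥) :
    ∃ m : loewySeries k C M 0, (m : M) ≠ 0 ∧ Gr.of (loewySeries k C M) 0 m ∈ P := by
  obtain ⟨x, hx, hx0⟩ := Submodule.exists_mem_ne_zero_of_ne_bot h0
  obtain ⟨N, e, he, y, hy, rfl⟩ := Gr.exists_leading hx0
  have h1 := not_mem_loewySeries_prev he
  have h2 : ∃ f : M →ₗ[k] k, coeff k C f e ∉ prev (coradicalFiltration k C) N := by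
    by_contra hcon
    push Not at hcon
    exact h1 (mem_tens_right_of_ctrL hcon)
  obtain ⟨f, hf⟩ := h2
  -- A form that separates the coefficient of `e` from `C_{N-1}`.
  obtain ⟨h, hne, hle⟩ := Submodule.exists_le_ker_of_notMem hf
  have hvan : ∀ u ∈ prev (coradicalFiltration k C) N, h u = 0 := fun u hu => hle hu
  -- The witness is the action of `h` on `e`. Its value under `f` is the value of `h` on the
  -- coefficient, hence nonzero.
  refine ⟨⟨ctrR h (ρ k C M e), ctrR_mem_zero isFiltered_coact hvan e.2⟩, fun hz => hne ?_, ?_⟩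
  · have h3 : h ∘ₗ ctrL f = f ∘ₗ ctrR h :=
      TensorProduct.ext' fun m c => by simp [mul_comm]
    have h4 := LinearMap.congr_fun h3 (ρ k C M e)
    simp only [LinearMap.comp_apply] at h4
    change h (ctrL f (ρ k C M e)) = 0
    rw [h4]
    exact (congrArg f hz).trans (map_zero f)
  -- Acting with the graded form stays in `P`. It kills the lower part `y` and sends the leading
  -- term to the class of the witness.
  · have h5 := isSubcomodule_iff.1 hP (formOfDegree (coradicalFiltration k C) N h hvan) _ hx
    have h6 : act k (GrCoalgebra k C) (GrComodule k C M)
        (formOfDegree (coradicalFiltration k C) N h hvan) y = 0 := by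
      have : Gr.lower (loewySeries k C M) N ≤ LinearMap.ker (act k (GrCoalgebra k C)
          (GrComodule k C M) (formOfDegree (coradicalFiltration k C) N h hvan)) :=
        Gr.lower_le fun n hn x => ctrR_formOfDegree_of_lt isFiltered_coact hn x
      exact this hy
    rw [map_add, h6, zero_add] at h5
    have h7 : act k (GrCoalgebra k C) (GrComodule k C M)
        (formOfDegree (coradicalFiltration k C) N h hvan) (Gr.of (loewySeries k C M) N e) = _ :=
      ctrR_formOfDegree_of isFiltered_coact e
    rwa [h7] at h5

/-- A simple `C`-comodule is simple over `gr C`. -/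
lemma IsSimpleComodule.isSimpleComodule_gr (hM : IsSimpleComodule k C M) :
    letI : RightComodule k (GrCoalgebra k C) M := hM.grComodule
    IsSimpleComodule k (GrCoalgebra k C) M := by
  let _ : RightComodule k (GrCoalgebra k C) M := hM.grComodule
  refine ⟨hM.1, fun Q hQ => hM.2 Q fun q hq => ?_⟩
  set π := Gr.proj (coradicalFiltration k C) 0
  -- Since `C₀` embeds in `gr C`, a left inverse `σ` recovers `ρ` from the structure map over `gr
  -- C`. Thus every subcomodule over `gr C` is one over `C`.
  have hinj : LinearMap.ker (π ∘ₗ (coradical k C).subtype) = ⊥ := by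
    rw [LinearMap.ker_eq_bot]
    intro a b hab
    exact Gr.of_zero_injective (F := coradicalFiltration k C)
      (((Gr.proj_coe (coradicalFiltration k C) 0 a).symm.trans hab).trans
        (Gr.proj_coe (coradicalFiltration k C) 0 b))
  obtain ⟨σ, hσ⟩ := (π ∘ₗ (coradical k C).subtype).exists_leftInverse_of_injective hinj
  have hs : ρ k C M q ∈ tens ⊤ (coradical k C) :=
    coact_mem_of_mem_socle (by rw [hM.socle_eq_top]; trivial)
  have key : tens ⊤ (coradical k C) ≤ LinearMap.eqLocus
      (((coradical k C).subtype ∘ₗ σ).lTensor M ∘ₗ π.lTensor M) LinearMap.id := by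
    refine tens_le fun m _ c hc => ?_
    have h1 : σ (π c) = ⟨c, hc⟩ := LinearMap.congr_fun hσ ⟨c, hc⟩
    rw [LinearMap.mem_eqLocus, LinearMap.comp_apply, LinearMap.lTensor_tmul, LinearMap.lTensor_tmul,
      LinearMap.comp_apply, h1]
    rfl
  have h2 := key hs
  rw [LinearMap.mem_eqLocus, LinearMap.comp_apply, LinearMap.id_apply] at h2
  rw [← h2]
  exact map_mem_tens (f := LinearMap.id) (P' := ⊤) (fun m hm => hm) (fun _ _ => trivial) (hQ q hq)

end Hom

/-! ### Injective comodules and injective envelopes -/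

section Envelopes

variable {k C : Type u} [Field k] [AddCommGroup C] [Module k C] [Coalgebra k C]
  {S E F : Type u} [AddCommGroup S] [Module k S] [RightComodule k C S]
  [AddCommGroup E] [Module k E] [RightComodule k C E]
  [AddCommGroup F] [Module k F] [RightComodule k C F]

/-- The regular comodule is injective. -/
lemma isInjectiveComodule_regular : IsInjectiveComodule k C C := by
  intro X Y _ _ _ _ _ _ i f hi hinj hf
  obtain ⟨r, hr⟩ := i.exists_leftInverse_of_injective (LinearMap.ker_eq_bot.2 hinj)
  -- A morphism into `C` is determined by its composite with the counit, so extending it along `i`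
  -- amounts to extending a linear form, for which a linear left inverse `r` of `i` is enough.
  refine ⟨coeff k C (Coalgebra.counit ∘ₗ f ∘ₗ r), coeff_hom _, LinearMap.ext fun x => ?_⟩
  rw [LinearMap.comp_apply, hi.coeff, LinearMap.comp_assoc, LinearMap.comp_assoc, hr,
    LinearMap.comp_id, ← hf.coeff, coeff_counit]

/-- A retract of an injective comodule is injective. -/
lemma IsInjectiveComodule.of_retract (hF : IsInjectiveComodule k C F) {i : E →ₗ[k] F}
    {r : F →ₗ[k] E} (hi : IsComoduleHom k C i) (hr : IsComoduleHom k C r)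
    (hri : r ∘ₗ i = LinearMap.id) : IsInjectiveComodule k C E := by
  intro X Y _ _ _ _ _ _ a f ha hinj hf
  obtain ⟨g, hg, hga⟩ := hF X Y a (i ∘ₗ f) ha hinj (hi.comp hf)
  exact ⟨r ∘ₗ g, hr.comp hg, by
    rw [LinearMap.comp_assoc, hga, ← LinearMap.comp_assoc, hri, LinearMap.id_comp]⟩

/-- A comodule morphism that is injective on an essential subcomodule is injective. -/
lemma IsInjectiveEnvelope.injective_of_comp {j : S →ₗ[k] E} (hj : IsInjectiveEnvelope k C j)
    {f : E →ₗ[k] F} (hf : IsComoduleHom k C f) (h : Function.Injective (f ∘ₗ j)) :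
    Function.Injective f := by
  rw [← LinearMap.ker_eq_bot]
  by_contra h0
  refine hj.essential _ hf.isSubcomodule_ker h0 ?_
  rw [eq_bot_iff]
  rintro _ ⟨hx, s, rfl⟩
  have h1 : (f ∘ₗ j) s = (f ∘ₗ j) 0 := by
    rw [map_zero]
    exact hx
  rw [h h1, map_zero]
  exact zero_mem _

/-- Injective envelopes are unique up to isomorphism. -/
lemma IsInjectiveEnvelope.exists_equiv {j : S →ₗ[k] E} (hj : IsInjectiveEnvelope k C j)
    {j' : S →ₗ[k] F} (hj' : IsInjectiveEnvelope k C j') :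
    ∃ e : E ≃ₗ[k] F, IsComoduleHom k C e.toLinearMap ∧ ∀ s, e (j s) = j' s := by
  obtain ⟨e, he, hej⟩ := hj'.isInjectiveComodule S E j j' hj.isComoduleHom hj.injective
    hj'.isComoduleHom
  have hinj : Function.Injective e := hj.injective_of_comp he (hej ▸ hj'.injective)
  -- Injectivity of `E` splits `e`. The splitting `r` is injective on the essential image of `j'`,
  -- because `r ∘ j' = j`, hence injective. So the left inverse `r` is also a right inverse.
  obtain ⟨r, hr, hre⟩ := hj.isInjectiveComodule E F e LinearMap.id he hinj isComoduleHom_id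
  have hrinj : Function.Injective r := hj'.injective_of_comp hr (by
    rw [← hej, ← LinearMap.comp_assoc, hre, LinearMap.id_comp]
    exact hj.injective)
  refine ⟨LinearEquiv.ofBijective e ⟨hinj, fun y => ⟨r y, hrinj ?_⟩⟩, he, fun s =>
    LinearMap.congr_fun hej s⟩
  exact LinearMap.congr_fun hre (r y)

/-- The injective envelope of a simple comodule is a retract of the regular comodule. -/
lemma IsInjectiveEnvelope.exists_retract (hS : IsSimpleComodule k C S) {ι : S →ₗ[k] E}
    (hι : IsInjectiveEnvelope k C ι) : ∃ (i : E →ₗ[k] C) (r : C →ₗ[k] E),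
      IsComoduleHom k C i ∧ IsComoduleHom k C r ∧ r ∘ₗ i = LinearMap.id := by
  have := hS.1
  obtain ⟨s, hs⟩ := exists_ne (0 : S)
  have hιs : ι s ≠ 0 := fun h => hs (hι.injective (h.trans (map_zero ι).symm))
  obtain ⟨f, hf⟩ : ∃ f : E →ₗ[k] k, f (ι s) ≠ 0 := by
    by_contra hcon
    push Not at hcon
    exact hιs ((Module.forall_dual_apply_eq_zero_iff k _).1 hcon)
  have hi := coeff_hom (C := C) f
  -- By essentiality it suffices to be injective on `S`. There the kernel is `0` or `S`, and the
  -- counit of the coefficient of `ι s` is `f (ι s) ≠ 0`.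
  have hinj : Function.Injective (coeff k C f) := by
    refine hι.injective_of_comp hi (LinearMap.ker_eq_bot.1 ?_)
    refine (hS.2 _ (hi.comp hι.isComoduleHom).isSubcomodule_ker).resolve_right fun h => hf ?_
    have h1 : s ∈ LinearMap.ker (coeff k C f ∘ₗ ι) := h ▸ trivial
    have h2 : coeff k C f (ι s) = 0 := h1
    rw [← counit_coeff (C := C), h2, map_zero]
  obtain ⟨r, hr, hri⟩ := hι.isInjectiveComodule E C (coeff k C f) LinearMap.id hi hinj
    isComoduleHom_id
  exact ⟨_, r, hi, hr, hri⟩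

/-- The graded comodule of a retract of the regular comodule is injective over `gr C`. -/
lemma isInjectiveComodule_gr {i : E →ₗ[k] C} {r : C →ₗ[k] E} (hi : IsComoduleHom k C i)
    (hr : IsComoduleHom k C r) (hri : r ∘ₗ i = LinearMap.id) :
    IsInjectiveComodule k (GrCoalgebra k C) (GrComodule k C E) := by
  have hi' : ∀ n, ∀ x ∈ loewySeries k C E n, i x ∈ coradicalFiltration k C n := fun n x hx =>
    mem_coradicalFiltration_iff.2 (hi.coact_mem_tens (mem_loewySeries_iff.1 hx))
  have hr' : ∀ n, ∀ x ∈ coradicalFiltration k C n, r x ∈ loewySeries k C E n := fun n x hx =>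
    mem_loewySeries_iff.2 (hr.coact_mem_tens (mem_coradicalFiltration_iff.1 hx))
  -- Both `i` and `r` preserve the filtrations, so `gr E` is a retract of `gr C`.
  refine (isInjectiveComodule_regular (C := GrCoalgebra k C)).of_retract (i := Gr.map i hi')
    (r := Gr.map r hr') (grMap_map isFiltered_coact isFiltered_comul hi' hi)
    (grMap_map isFiltered_comul isFiltered_coact hr' hr) (Gr.hom_ext fun n x => ?_)
  rw [LinearMap.comp_apply, Gr.map_of, Gr.map_of, LinearMap.id_apply]
  exact congrArg _ (Subtype.ext (LinearMap.congr_fun hri x))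

/-- The socle of the injective envelope of a simple comodule `S` is `S`. -/
lemma IsInjectiveEnvelope.loewySeries_zero (hS : IsSimpleComodule k C S) {ι : S →ₗ[k] E}
    (hι : IsInjectiveEnvelope k C ι) : loewySeries k C E 0 = LinearMap.range ι := by
  refine le_antisymm (sSup_le fun T hT => ?_) ?_
  -- Essentiality makes a simple `T` meet the image of `ι`, and simplicity puts it inside.
  · have h1 := (hT.2.2 _ inf_le_left (hT.1.inf hι.isComoduleHom.isSubcomodule_range)).resolve_left
      (hι.essential T hT.1 hT.2.1)
    exact inf_eq_left.1 h1
  · rw [LinearMap.range_eq_map, ← hS.socle_eq_top]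
    exact hι.isComoduleHom.map_socle

/-- The inclusion of the simple comodule `S` in degree zero of `gr E` is an injective envelope
over `gr C`, for an injective envelope `E` of `S`. -/
lemma IsInjectiveEnvelope.gr (hS : IsSimpleComodule k C S) {ι : S →ₗ[k] E}
    (hι : IsInjectiveEnvelope k C ι) (hmem : ∀ s, ι s ∈ loewySeries k C E 0) :
    letI : RightComodule k (GrCoalgebra k C) S := hS.grComodule
    IsInjectiveEnvelope k (GrCoalgebra k C)
      (Gr.of (loewySeries k C E) 0 ∘ₗ ι.codRestrict _ hmem) := by
  let _ : RightComodule k (GrCoalgebra k C) S := hS.grComodule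
  refine ⟨?_, ?_, ?_, fun P hP h0 => ?_⟩
  · refine LinearMap.ext fun s => ?_
    change grMap isFiltered_coact (Gr.of (loewySeries k C E) 0 ⟨ι s, hmem s⟩) = _
    -- In degree zero only the bidegree `(0, 0)` occurs, so the graded structure map is `ρ` with
    -- `C₀` viewed in `gr C`, as in the definition of `S` over `gr C`.
    rw [grMap_of, grAux, Finset.Nat.antidiagonal_zero, Finset.sum_singleton]
    have h1 : ρ k C E (ι s) = ι.rTensor C (ρ k C S s) := LinearMap.congr_fun hι.isComoduleHom s
    change _ = (Gr.of (loewySeries k C E) 0 ∘ₗ ι.codRestrict _ hmem).rTensor (GrCoalgebra k C)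
      ((Gr.proj (coradicalFiltration k C) 0).lTensor S (ρ k C S s))
    rw [LinearMap.comp_apply, h1]
    generalize ρ k C S s = y
    induction y with
    | zero => simp only [map_zero]
    | add a b ha hb => simp only [map_add, ha, hb]
    | tmul t c =>
      simp only [LinearMap.rTensor_tmul, LinearMap.lTensor_tmul, TensorProduct.map_tmul]
      rw [Gr.proj_of_mem _ 0 (hmem t)]
      rfl
  · exact Gr.of_zero_injective.comp fun a b hab => hι.injective (congrArg Subtype.val hab)
  · obtain ⟨i, r, hi, hr, hri⟩ := hι.exists_retract hS
    exact isInjectiveComodule_gr hi hr hri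
  · obtain ⟨m, hm0, hm⟩ := exists_mem_of_isSubcomodule_gr hP h0
    -- The degree-zero part of `gr E` is the socle of `E`, hence comes from `S`.
    obtain ⟨s, hs⟩ : (m : E) ∈ LinearMap.range ι := hι.loewySeries_zero hS ▸ m.2
    intro h
    have h1 : Gr.of (loewySeries k C E) 0 m ∈ (⊥ : Submodule k (GrComodule k C E)) := by
      rw [← h]
      exact ⟨hm, s, congrArg (Gr.of (loewySeries k C E) 0) (Subtype.ext hs)⟩
    refine hm0 ?_
    rw [Gr.of_zero_injective (((Submodule.mem_bot k).1 h1).trans (map_zero _).symm)]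
    rfl

end Envelopes

end CoalgGr

open CoalgGr
theorem mainTheorem3 {k C S E : Type u} [Field k] [AddCommGroup C] [Module k C] [Coalgebra k C]
    [AddCommGroup S] [Module k S] [RightComodule k C S] (hS : IsSimpleComodule k C S)
    [AddCommGroup E] [Module k E] [RightComodule k C E] (ι : S →ₗ[k] E)
    (hι : IsInjectiveEnvelope k C ι) :
    letI : RightComodule k (GrCoalgebra k C) S := hS.grComodule
    IsSimpleComodule k (GrCoalgebra k C) S ∧
    ∃ j : S →ₗ[k] GrComodule k C E,
      (∀ s, ∃ h : ι s ∈ loewySeries k C E 0, j s = Gr.of (loewySeries k C E) 0 ⟨ι s, h⟩) ∧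
      IsInjectiveEnvelope k (GrCoalgebra k C) j ∧
      ∀ (F : Type u) [AddCommGroup F] [Module k F] [RightComodule k (GrCoalgebra k C) F]
        (j' : S →ₗ[k] F), IsInjectiveEnvelope k (GrCoalgebra k C) j' →
        ∃ e : GrComodule k C E ≃ₗ[k] F,
          IsComoduleHom k (GrCoalgebra k C) e.toLinearMap ∧ ∀ s, e (j s) = j' s := by
  have hmem : ∀ s, ι s ∈ loewySeries k C E 0 := fun s => by
    rw [hι.loewySeries_zero hS]
    exact ⟨s, rfl⟩
  let _ : RightComodule k (GrCoalgebra k C) S := hS.grComodule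
  exact ⟨hS.isSimpleComodule_gr, _, fun s => ⟨hmem s, rfl⟩, hι.gr hS hmem,
    fun F _ _ _ j' hj' => (hι.gr hS hmem).exists_equiv hj'⟩
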